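/- Let $a=(a_\ell)_{\ell\in\mathbb Z}$ be a finitely supported complex sequence with $\sum_{\ell} a_\ell=1$, and put $\widehat F_a(\theta):=\sum_{\ell\in\mathbb Z}a_\ell\,e^{\mathbf i\ell\theta}$ for $\theta\in\mathbb C$. Assume the dissipation condition $|\widehat F_a(\theta)|<1$ for every real $\theta\in[-\pi,\pi]\setminus\{0\}$, and assume that there are $\alpha\in\mathbb R$, $c_3>0$, $c_4>0$ and a function $\varphi$, holomorphic on a neighborhood of $0$ in $\mathbb C$, such that, for all complex $\theta$ close to $0$, $$\widehat F_a(\theta)=\exp\left(\mathbf i\alpha\theta-\mathbf i c_3\theta^3-c_4\theta^4+\theta^5\varphi(\theta)\right).$$ Let $L_a$ be the convolution operator $(L_a u)_j=\sum_{\ell\in\mathbb Z}a_\ell u_{j-\ell}$, let $\boldsymbol\delta$ be the discrete Dirac mass at $0$, and let $\mathcal G^n_j:=(L_a^n\boldsymbol\delta)_j$ be the Green's function. For $n\ge1$ and $j\in\mathbb Z$ define the approximate Green's function $$\mathbb G^n_j:=\frac1\pi\exp\left(-\frac{c_4(j-\alpha n)^2}{9c_3^2n}\right)\cos\left(\frac{2|j-\alpha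 n|^{3/2}}{3\sqrt{3c_3n}}-\frac\pi4\right)\int_{-\sqrt{\frac{2|j-\alpha n|}{3c_3n}}}^{\sqrt{\frac{2|j-\alpha n|}{3c_3n}}}e^{-\sqrt{3c_3n|j-\alpha n|}\,u^2}\,du.$$ Then there exists a constant $C>0$ such that, for every integer $n\ge1$, $$\sum_{j\in\mathbb Z:\ j-\alpha n\ge0}|\mathcal G^n_j|\le C\qquad\text{and}\qquad\sum_{j\in\mathbb Z:\ j-\alpha n<0}|\mathcal G^n_j-\mathbb G^n_j|\le C.$$ -/

import Mathlib

open scoped Topology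

noncomputable section

/-- The Laurent (convolution) operator `L_a`, sending `u` to `a ⋆ u`. -/
def laurentOp (a u : ℤ → ℂ) : ℤ → ℂ :=
  fun j => ∑' l : ℤ, a l * u (j - l)

/-- The discrete Dirac mass. -/
def diracMass : ℤ → ℂ :=
  fun j => if j = 0 then 1 else 0

/-- The Green's function `𝒢_j^n = (L_a^n δ)_j`. -/
def greenFn (a : ℤ → ℂ) (n : ℕ) (j : ℤ) : ℂ :=
  ((laurentOp a)^[n] diracMass) j

/-- The Fourier transform of `a`. For a finitely supported `a` it is a trigonometric polynomial,
which makes sense at every complex argument. -/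
def fourierSymbol (a : ℤ → ℂ) (θ : ℂ) : ℂ :=
  ∑' l : ℤ, a l * Complex.exp (Complex.I * l * θ)

/-- The standing assumption on `a`, with the numbers `α`, `c₃`, `c₄` of the expansion at `0`. -/
structure DispersiveAssumption (a : ℤ → ℂ) (α c₃ c₄ : ℝ) : Prop where
  finite_support : (Function.support a).Finite
  sum_eq_one : ∑' l : ℤ, a l = 1
  dissipation : ∀ θ : ℝ, θ ∈ Set.Icc (-Real.pi) Real.pi → θ ≠ 0 → ‖fourierSymbol a (θ : ℂ)‖ < 1
  c₃_ne_zero : c₃ ≠ 0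
  c₄_pos : 0 < c₄
  expansion : ∃ φ : ℂ → ℂ, AnalyticAt ℂ φ 0 ∧
    ∀ᶠ θ : ℂ in 𝓝 0, fourierSymbol a θ =
      Complex.exp (Complex.I * α * θ - Complex.I * c₃ * θ ^ 3 - c₄ * θ ^ 4 + θ ^ 5 * φ θ)

/-- The approximate Green's function `𝔾_j^n`. -/
def approxGreenFn (α c₃ c₄ : ℝ) (n : ℕ) (j : ℤ) : ℝ :=
  1 / Real.pi * Real.exp (-(c₄ * ((j : ℝ) - α * n) ^ 2 / (9 * c₃ ^ 2 * n))) *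
    Real.cos (2 * |(j : ℝ) - α * n| ^ (3 / 2 : ℝ) / (3 * Real.sqrt (3 * c₃ * n)) - Real.pi / 4) *
    ∫ u in (-Real.sqrt (2 * |(j : ℝ) - α * n| / (3 * c₃ * n)))..
        (Real.sqrt (2 * |(j : ℝ) - α * n| / (3 * c₃ * n))),
      Real.exp (-(Real.sqrt (3 * c₃ * n * |(j : ℝ) - α * n|) * u ^ 2))

end

/-!
Write `x = j - α n`. Since the symbol is entire and `2π`-periodic, `2π` times the Green's function
is the integral of `F(θ) ^ n e^{-ijθ}` over one period of any horizontal line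
(`two_pi_mul_greenFn`), and near the origin the integrand is
`exp (-ixθ - i c₃ n θ³ - c₄ n θ⁴ + …)`. Away from the origin dissipation makes it exponentially
small in `n`.

On the side `x ≥ 0` there is no real stationary point. On the line `Im θ = -ε n ^ (-1/3)` the cubic
term produces a Gaussian factor, whence a bound of size `n ^ (-1/3)` decaying exponentially in
`x / n ^ (1/3)` (`exists_greenFn_bound_right`). The same bound covers the Airy layer
`|x| ≤ n ^ (1/3)`. For `x ≤ -ρ n` a line above the axis yields exponential decay in `|x|`
(`exists_greenFn_bound_far_left`).

In the remaining range there are two saddle points `±η` with `|x| = 3 c₃ n η²`. The contour is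
deformed to the broken line through `-2η - iη`, `iη`, `2η - iη`, whose two oblique pieces are the
steepest-descent directions at `±η`; by `integral_eq_integral_oblique` this only needs a primitive
of the entire integrand. The approximate Green's function is exactly the integral of the Gaussian
part of the exponent over the two pieces (`two_pi_mul_approxGreenFn`). The approximation error
(`exists_greenFn_sub_approxGreenFn_bound`) has three sources. The cubic Taylor term enters only
through its square, because its first-order contribution is odd, and together with the horizontal
parts of the contour gives errors at scale `n ^ (1/3)`; the variation of the quartic term and the
remainder give errors at scale `n ^ (1/2)`.

Every error is thus dominated by `N⁻¹ (1 + |x| / N) ^ (-3/2)` with `N` one of `n ^ (1/3)`,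
`n ^ (1/2)`, `1` (`exists_pointwise_bound`), and the sum of this profile over a lattice of unit mesh
is bounded independently of `N ≥ 1` (`summable_decayProfile_and_tsum_le`).
-/

open ComplexConjugate

/-! ### Lattice sums of a slowly decaying profile -/

/-- The profile `s ↦ (1 + s) ^ (-3/2)`, rescaled to width `N` and height `1 / N`, so that its sums
over unit-spaced points are bounded independently of `N ≥ 1`. Powers of a square root stand for
the half-integer exponent. -/
noncomputable def decayProfile (N y : ℝ) : ℝ := 1 / (N * √(1 + y / N) ^ 3)

lemma decayProfile_nonneg {N y : ℝ} (hN : 0 ≤ N) : 0 ≤ decayProfile N y := by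
  unfold decayProfile; positivity

lemma decayProfile_succ_le {N : ℝ} (hN : 1 ≤ N) (k : ℕ) :
    decayProfile N (k + 1 : ℕ) ≤ 2 * (1 / √(1 + k / N) - 1 / √(1 + (k + 1 : ℕ) / N)) := by
  unfold decayProfile
  have hN0 : 0 < N := by linarith
  have hpa : 0 < 1 + (k : ℝ) / N := by positivity
  have hpb : 0 < 1 + ((k + 1 : ℕ) : ℝ) / N := by positivity
  have ha := Real.sqrt_pos.2 hpa
  have hb := Real.sqrt_pos.2 hpb
  have hab : √(1 + (k : ℝ) / N) ≤ √(1 + ((k + 1 : ℕ) : ℝ) / N) :=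
    Real.sqrt_le_sqrt (by push_cast; gcongr; linarith)
  have h1 := Real.sq_sqrt hpa.le
  have h2 := Real.sq_sqrt hpb.le
  have h3 : N * (√(1 + ((k + 1 : ℕ) : ℝ) / N) ^ 2 - √(1 + (k : ℝ) / N) ^ 2) = 1 := by
    rw [h1, h2]; push_cast; field_simp; ring
  generalize √(1 + (k : ℝ) / N) = a at *
  generalize √(1 + ((k + 1 : ℕ) : ℝ) / N) = b at *
  have : 2 * (1 / a - 1 / b) = 2 / (N * (a * b * (a + b))) := by
    field_simp
    linear_combination h3
  rw [this, div_le_div_iff₀ (by positivity) (by positivity)]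
  have : a * b * (a + b) ≤ b * b * (b + b) := by gcongr
  nlinarith

lemma sum_range_decayProfile_le {N : ℝ} (hN : 1 ≤ N) (m : ℕ) :
    ∑ k ∈ Finset.range m, decayProfile N k ≤ 3 := by
  have key : ∀ m : ℕ, ∑ k ∈ Finset.range (m + 1), decayProfile N k
      ≤ 3 - 2 * (1 / √(1 + m / N)) := by
    intro m
    induction m with
    | zero =>
      have : 1 / N ≤ 1 := by rw [div_le_one (by linarith)]; exact hN
      simp [decayProfile] at this ⊢
      linarith
    | succ m ih =>
      rw [Finset.sum_range_succ]
      have := decayProfile_succ_le hN m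
      linarith
  rcases m with _ | m
  · simp
  · have : 0 ≤ 1 / √(1 + m / N) := by positivity
    linarith [key m]

lemma summable_decayProfile_nat {N : ℝ} (hN : 1 ≤ N) :
    Summable fun k : ℕ => decayProfile N k :=
  summable_of_sum_range_le (fun _ => decayProfile_nonneg (by linarith))
    (sum_range_decayProfile_le hN)

lemma tsum_decayProfile_nat_le {N : ℝ} (hN : 1 ≤ N) : ∑' k : ℕ, decayProfile N k ≤ 3 :=
  Real.tsum_le_of_sum_range_le (fun _ => decayProfile_nonneg (by linarith))
    (sum_range_decayProfile_le hN)

lemma decayProfile_le_of_le_add_one {N y k : ℝ} (hN : 1 ≤ N) (hy : 0 ≤ y) (hk : 0 ≤ k)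
    (h : k ≤ y + 1) : decayProfile N y ≤ 8 * decayProfile N k := by
  unfold decayProfile
  have hN0 : 0 < N := by linarith
  have h1 : √(1 + k / N) ≤ 2 * √(1 + y / N) := by
    rw [show (2 : ℝ) = √4 by rw [show (4 : ℝ) = 2 ^ 2 by norm_num]; simp,
      ← Real.sqrt_mul (by norm_num)]
    apply Real.sqrt_le_sqrt
    have h2 : k / N ≤ (y + 1) / N := by gcongr
    have h3 : 1 / N ≤ 1 := by rw [div_le_one hN0]; exact hN
    have h4 : 0 ≤ y / N := by positivity
    rw [add_div] at h2
    linarith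
  have h2 : √(1 + k / N) ^ 3 ≤ (2 * √(1 + y / N)) ^ 3 := by gcongr
  have h3 : 0 < √(1 + k / N) := Real.sqrt_pos.2 (by positivity)
  have h4 : 0 < √(1 + y / N) := Real.sqrt_pos.2 (by positivity)
  rw [mul_one_div, div_le_div_iff₀ (by positivity) (by positivity)]
  nlinarith

/-- The profile has bounded mass on every translate of the lattice of unit mesh. -/
lemma summable_decayProfile_and_tsum_le {N : ℝ} (hN : 1 ≤ N) (β : ℝ) :
    Summable (fun j : ℤ => decayProfile N |(j : ℝ) - β|) ∧
      ∑' j : ℤ, decayProfile N |(j : ℝ) - β| ≤ 48 := by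
  set g : ℤ → ℝ := fun k => decayProfile N |((⌊β⌋ + k : ℤ) : ℝ) - β|
  have hf1 := Int.floor_le β
  have hf2 := Int.lt_floor_add_one β
  have h1 : ∀ k : ℕ, g k ≤ 8 * decayProfile N k := fun k =>
    decayProfile_le_of_le_add_one hN (abs_nonneg _) (by positivity) (by
      have := le_abs_self (((⌊β⌋ + k : ℤ) : ℝ) - β)
      push_cast at this ⊢
      linarith)
  have h2 : ∀ k : ℕ, g (-(k + 1)) ≤ 8 * decayProfile N k := fun k =>
    decayProfile_le_of_le_add_one hN (abs_nonneg _) (by positivity) (by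
      have := neg_abs_le (((⌊β⌋ + -((k : ℤ) + 1) : ℤ) : ℝ) - β)
      push_cast at this ⊢
      linarith)
  have hnn : ∀ k, 0 ≤ g k := fun k => decayProfile_nonneg (by linarith)
  have hs := (summable_decayProfile_nat hN).mul_left 8
  have hs1 : Summable fun k : ℕ => g k := Summable.of_nonneg_of_le (fun _ => hnn _) h1 hs
  have hs2 : Summable fun k : ℕ => g (-(k + 1)) :=
    Summable.of_nonneg_of_le (fun _ => hnn _) h2 hs
  have ht : ∑' k, g k ≤ 48 := by
    rw [tsum_of_nat_of_neg_add_one hs1 hs2]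
    have e1 := hs1.tsum_le_tsum h1 hs
    have e2 := hs2.tsum_le_tsum h2 hs
    rw [tsum_mul_left] at e1 e2
    linarith [tsum_decayProfile_nat_le hN]
  have hs3 : Summable g := Summable.of_nat_of_neg_add_one hs1 hs2
  constructor
  · exact (Equiv.addLeft ⌊β⌋).summable_iff.1 hs3
  · rw [← (Equiv.addLeft ⌊β⌋).tsum_eq]
    exact ht

/-! ### Comparison of exponentials with the profile -/

lemma exists_one_add_pow_mul_exp_neg_le {c : ℝ} (hc : 0 < c) (k : ℕ) :
    ∃ C : ℝ, 0 < C ∧ ∀ s : ℝ, 0 ≤ s → (1 + s) ^ k * Real.exp (-(c * s)) ≤ C := by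
  refine ⟨k.factorial / c ^ k * Real.exp c, by positivity, fun s hs => ?_⟩
  have h := Real.pow_div_factorial_le_exp (c * (1 + s)) (by positivity) k
  have : Real.exp (-(c * s)) = Real.exp c / Real.exp (c * (1 + s)) := by
    rw [← Real.exp_sub]; congr 1; ring
  rw [this, mul_pow, div_le_iff₀ (by positivity)] at *
  rw [← mul_div_assoc, div_le_iff₀ (Real.exp_pos _)]
  calc (1 + s) ^ k * Real.exp c = (c ^ k * (1 + s) ^ k) / c ^ k * Real.exp c := by
        field_simp
    _ ≤ (Real.exp (c * (1 + s)) * k.factorial) / c ^ k * Real.exp c := by gcongr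
    _ = _ := by ring

lemma inv_sq_le_decayProfile {N y : ℝ} (hN : 0 < N) (hy : 0 ≤ y) :
    1 / (N * (1 + y / N) ^ 2) ≤ decayProfile N y := by
  unfold decayProfile
  have h0 : 0 ≤ y / N := by positivity
  have h1 : 1 ≤ √(1 + y / N) := by rw [Real.one_le_sqrt]; linarith
  have h2 : (1 + y / N) ^ 2 = √(1 + y / N) ^ 4 := by
    rw [show 4 = 2 * 2 by norm_num, pow_mul, Real.sq_sqrt (by linarith)]
  rw [h2]
  gcongr
  all_goals linarith

/-- Exponential decay at scale `N`, even against a polynomial factor, is dominated by the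
profile. -/
lemma exists_exp_le_decayProfile {c : ℝ} (hc : 0 < c) (k : ℕ) :
    ∃ C : ℝ, 0 < C ∧ ∀ N y : ℝ, 0 < N → 0 ≤ y →
      (1 + y / N) ^ k * Real.exp (-(c * (y / N))) / N ≤ C * decayProfile N y := by
  obtain ⟨C, hC, h⟩ := exists_one_add_pow_mul_exp_neg_le hc (k + 2)
  refine ⟨C, hC, fun N y hN hy => ?_⟩
  have h1 := h (y / N) (by positivity)
  refine le_trans ?_ (mul_le_mul_of_nonneg_left (inv_sq_le_decayProfile hN hy) hC.le)
  rw [mul_one_div, div_le_div_iff₀ hN (by positivity)]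
  calc (1 + y / N) ^ k * Real.exp (-(c * (y / N))) * (N * (1 + y / N) ^ 2)
      = ((1 + y / N) ^ (k + 2) * Real.exp (-(c * (y / N)))) * N := by ring
    _ ≤ C * N := by gcongr

/-! ### Gaussian integrals over intervals -/

lemma integral_exp_neg_mul_sq_le {b : ℝ} (hb : 0 < b) {s t : ℝ} (hst : s ≤ t) :
    ∫ u in s..t, Real.exp (-b * u ^ 2) ≤ √(Real.pi / b) := by
  rw [intervalIntegral.integral_of_le hst, ← integral_gaussian b]
  exact MeasureTheory.setIntegral_le_integral (integrable_exp_neg_mul_sq hb)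
    (Filter.Eventually.of_forall fun _ => (Real.exp_pos _).le)

lemma norm_integral_le_of_le_gaussian_add {f : ℝ → ℂ} {A B b s t : ℝ} (hb : 0 < b) (hst : s ≤ t)
    (hA : 0 ≤ A) (hf : ∀ u ∈ Set.Icc s t, ‖f u‖ ≤ A * Real.exp (-b * u ^ 2) + B) :
    ‖∫ u in s..t, f u‖ ≤ A * √(Real.pi / b) + (t - s) * B := by
  have hi : IntervalIntegrable (fun u : ℝ => A * Real.exp (-b * u ^ 2)) MeasureTheory.volume s t :=
    Continuous.intervalIntegrable (by fun_prop) _ _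
  refine (intervalIntegral.norm_integral_le_of_norm_le hst
    (Filter.Eventually.of_forall fun u hu => hf u ⟨hu.1.le, hu.2⟩)
    (hi.add intervalIntegrable_const)).trans ?_
  rw [intervalIntegral.integral_add hi intervalIntegrable_const,
    intervalIntegral.integral_const_mul, intervalIntegral.integral_const, smul_eq_mul]
  gcongr
  exact integral_exp_neg_mul_sq_le hb hst

lemma norm_integral_le_of_le_gaussian {f : ℝ → ℂ} {A b s t : ℝ} (hb : 0 < b) (hst : s ≤ t)
    (hA : 0 ≤ A) (hf : ∀ u ∈ Set.Icc s t, ‖f u‖ ≤ A * Real.exp (-b * u ^ 2)) :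
    ‖∫ u in s..t, f u‖ ≤ A * √(Real.pi / b) := by
  simpa using norm_integral_le_of_le_gaussian_add (B := 0) hb hst hA (by simpa using hf)

/-! ### Contour representation of the Green's function -/

/-- The integrand `F(θ) ^ n e^{-ijθ}` whose integral over a period is `2π` times the Green's
function. -/
noncomputable def greenIntegrand (a : ℤ → ℂ) (n : ℕ) (j : ℤ) (θ : ℂ) : ℂ :=
  fourierSymbol a θ ^ n * Complex.exp (-(Complex.I * j * θ))

lemma fourierSymbol_eq_sum {a : ℤ → ℂ} (ha : (Function.support a).Finite) (θ : ℂ) :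
    fourierSymbol a θ = ∑ l ∈ ha.toFinset, a l * Complex.exp (Complex.I * l * θ) :=
  tsum_eq_sum fun l hl => by
    have : a l = 0 := by simpa using hl
    simp [this]

lemma laurentOp_eq_sum {a : ℤ → ℂ} (ha : (Function.support a).Finite) (u : ℤ → ℂ) (j : ℤ) :
    laurentOp a u j = ∑ l ∈ ha.toFinset, a l * u (j - l) :=
  tsum_eq_sum fun l hl => by
    have : a l = 0 := by simpa using hl
    simp [this]

lemma differentiable_fourierSymbol {a : ℤ → ℂ} (ha : (Function.support a).Finite) :
    Differentiable ℂ (fourierSymbol a) := by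
  rw [funext (fourierSymbol_eq_sum ha)]
  fun_prop

lemma differentiable_greenIntegrand {a : ℤ → ℂ} (ha : (Function.support a).Finite) (n : ℕ)
    (j : ℤ) : Differentiable ℂ (greenIntegrand a n j) := by
  have := differentiable_fourierSymbol ha
  unfold greenIntegrand
  fun_prop

lemma continuous_greenIntegrand {a : ℤ → ℂ} (ha : (Function.support a).Finite) (n : ℕ)
    (j : ℤ) : Continuous (greenIntegrand a n j) :=
  (differentiable_greenIntegrand ha n j).continuous

lemma integral_exp_shifted (j : ℤ) (τ : ℝ) :
    ∫ u in (-Real.pi)..Real.pi, Complex.exp (-(Complex.I * j * (u + τ * Complex.I)))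
      = 2 * Real.pi * diracMass j := by
  by_cases hj : j = 0
  · subst hj
    simp [diracMass]
    ring
  · have hc : -(Complex.I * j) ≠ 0 := by simp [hj]
    have h : ∀ u : ℝ, Complex.exp (-(Complex.I * j * (u + τ * Complex.I)))
        = Complex.exp (-(Complex.I * j) * (τ * Complex.I)) * Complex.exp (-(Complex.I * j) * u) := by
      intro u
      rw [← Complex.exp_add]; congr 1; ring
    simp_rw [h]
    rw [intervalIntegral.integral_const_mul, integral_exp_mul_complex hc]
    have : Complex.exp (-(Complex.I * j) * (Real.pi : ℝ))
        = Complex.exp (-(Complex.I * j) * ((-Real.pi : ℝ) : ℂ)) := by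
      rw [Complex.exp_eq_exp_iff_exists_int]
      exact ⟨-j, by push_cast; ring⟩
    rw [this]
    simp [diracMass, hj]

/-- Fourier inversion on any horizontal line: the contour may be shifted freely into the complex
plane. -/
lemma two_pi_mul_greenFn {a : ℤ → ℂ} (ha : (Function.support a).Finite) (τ : ℝ) (n : ℕ) (j : ℤ) :
    2 * Real.pi * greenFn a n j
      = ∫ u in (-Real.pi)..Real.pi, greenIntegrand a n j (u + τ * Complex.I) := by
  induction n generalizing j with
  | zero =>
    simp only [greenIntegrand, pow_zero, one_mul, integral_exp_shifted, greenFn,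
      Function.iterate_zero, id]
  | succ n ih =>
    have h1 : greenFn a (n + 1) j = ∑ l ∈ ha.toFinset, a l * greenFn a n (j - l) := by
      simp only [greenFn, Function.iterate_succ', Function.comp_apply, laurentOp_eq_sum ha]
    have h2 : ∀ θ : ℂ, greenIntegrand a (n + 1) j θ
        = ∑ l ∈ ha.toFinset, a l * greenIntegrand a n (j - l) θ := by
      intro θ
      simp only [greenIntegrand, pow_succ]
      conv_lhs => rw [mul_assoc, fourierSymbol_eq_sum ha θ, Finset.sum_mul, Finset.mul_sum]
      rw [← fourierSymbol_eq_sum ha θ]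
      refine Finset.sum_congr rfl fun l _ => ?_
      have : Complex.exp (-(Complex.I * (j - l : ℤ) * θ))
          = Complex.exp (Complex.I * l * θ) * Complex.exp (-(Complex.I * j * θ)) := by
        rw [← Complex.exp_add]; congr 1; push_cast; ring
      rw [this]; ring
    simp_rw [h2]
    rw [intervalIntegral.integral_finsetSum, h1, Finset.mul_sum]
    · refine Finset.sum_congr rfl fun l _ => ?_
      rw [intervalIntegral.integral_const_mul, ← ih]
      ring
    · intro l _
      have := continuous_greenIntegrand ha n (j - l)
      exact Continuous.intervalIntegrable (by fun_prop) _ _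

/-- The horizontal segment from `-2η - iη` to `2η - iη` may be replaced by the two oblique
segments meeting at `iη`, which are the steepest-descent directions at the saddle points `±η`. -/
lemma integral_eq_integral_oblique {f : ℂ → ℂ} (hf : Differentiable ℂ f) (η : ℝ) :
    ∫ u in (-(2 * η))..(2 * η), f (u + (-η : ℝ) * Complex.I)
      = (∫ t in (-η)..η, f (η + t * (1 - Complex.I)) * (1 - Complex.I))
        + ∫ t in (-η)..η, f (-(η + t * (1 + Complex.I))) * (1 + Complex.I) := by
  obtain ⟨P, hP⟩ := hf.isExactOn_univ
  replace hP : ∀ z, HasDerivAt P (f z) z := fun z => hP z (Set.mem_univ z)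
  have hfc := hf.continuous
  have seg : ∀ (z ω : ℂ) (s t : ℝ), ∫ u in s..t, f (z + u * ω) * ω = P (z + t * ω) - P (z + s * ω) := by
    intro z ω s t
    refine intervalIntegral.integral_eq_sub_of_hasDerivAt (f := fun u : ℝ => P (z + u * ω))
      (fun u _ => ?_) (Continuous.intervalIntegrable (by fun_prop) _ _)
    have h1 : HasDerivAt (fun u : ℝ => z + u * ω) ω u := by
      simpa using ((Complex.ofRealCLM.hasDerivAt (x := u)).mul_const ω).const_add z
    exact (hP _).comp_of_eq u h1 rfl
  have e1 := seg ((-η : ℝ) * Complex.I) 1 (-(2 * η)) (2 * η)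
  have e2 := seg η (1 - Complex.I) (-η) η
  have e3 := seg (-η) (-(1 + Complex.I)) (-η) η
  simp only [mul_one, mul_neg, intervalIntegral.integral_neg] at e1 e2 e3
  simp_rw [add_comm ((-η : ℝ) * Complex.I)] at e1
  rw [e1, e2]
  have e4 : ∀ t : ℝ, -((η : ℂ) + t * (1 + Complex.I)) = -η + -(t * (1 + Complex.I)) := by
    intro t; ring
  simp_rw [e4]
  rw [neg_eq_iff_eq_neg] at e3
  rw [e3]
  have p1 : ((2 * η : ℝ) : ℂ) + (-η : ℝ) * Complex.I = η + η * (1 - Complex.I) := by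
    push_cast; ring
  have p2 : ((-(2 * η) : ℝ) : ℂ) + (-η : ℝ) * Complex.I = -η + -(η * (1 + Complex.I)) := by
    push_cast; ring
  have p3 : (η : ℂ) + ((-η : ℝ) : ℂ) * (1 - Complex.I) = -η + -(((-η : ℝ) : ℂ) * (1 + Complex.I)) := by
    push_cast; ring
  rw [p1, p2, p3]
  ring

/-! ### Size of the symbol near the real axis -/

/-- The exponent of the symbol at the origin once the transport term `iαθ` is removed; `p` stands
for the value of the analytic remainder. -/
noncomputable def localExponent (c₃ c₄ : ℝ) (p θ : ℂ) : ℂ :=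
  -(Complex.I * c₃ * θ ^ 3) - c₄ * θ ^ 4 + θ ^ 5 * p

lemma exists_local_expansion {a : ℤ → ℂ} {α c₃ c₄ : ℝ} (ha : DispersiveAssumption a α c₃ c₄) :
    ∃ r M : ℝ, 0 < r ∧ 0 < M ∧ ∀ θ : ℂ, ‖θ‖ ≤ r → ∃ p : ℂ, ‖p‖ ≤ M ∧
      fourierSymbol a θ = Complex.exp (Complex.I * α * θ + localExponent c₃ c₄ p θ) := by
  obtain ⟨φ, hφ, h⟩ := ha.expansion
  have hb : ∀ᶠ θ in 𝓝 (0 : ℂ), ‖φ θ‖ < ‖φ 0‖ + 1 :=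
    hφ.continuousAt.norm.eventually (gt_mem_nhds (lt_add_one _))
  obtain ⟨r, hr, H⟩ := Metric.eventually_nhds_iff.1 (h.and hb)
  refine ⟨r / 2, ‖φ 0‖ + 1, by positivity, by positivity, fun θ hθ => ?_⟩
  obtain ⟨h1, h2⟩ := H (y := θ) (by rw [dist_zero_right]; linarith)
  refine ⟨φ θ, h2.le, h1.trans ?_⟩
  congr 1
  unfold localExponent
  ring

lemma re_localExponent_le {c₃ c₄ M r u τ : ℝ} {p : ℂ} (hM : 0 < M) (hp : ‖p‖ ≤ M)
    (hr : ‖(u + τ * Complex.I : ℂ)‖ ≤ r) (hMr : 4 * (M * r) ≤ c₄) :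
    (localExponent c₃ c₄ p (u + τ * Complex.I)).re
      ≤ c₃ * (3 * u ^ 2 * τ - τ ^ 3) + 6 * c₄ * u ^ 2 * τ ^ 2 - c₄ / 2 * u ^ 4 := by
  set θ : ℂ := u + τ * Complex.I with hθ
  have hn : ‖θ‖ ^ 2 = u ^ 2 + τ ^ 2 := by
    rw [hθ, ← Complex.normSq_eq_norm_sq, Complex.normSq_add_mul_I]
  have h5 : (θ ^ 5 * p).re ≤ c₄ / 2 * (u ^ 4 + τ ^ 4) := by
    have hr0 : 0 ≤ r := (norm_nonneg _).trans hr
    calc (θ ^ 5 * p).re ≤ ‖θ ^ 5 * p‖ := Complex.re_le_norm _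
      _ = ‖θ‖ * (‖θ‖ ^ 2) ^ 2 * ‖p‖ := by rw [norm_mul, norm_pow]; ring
      _ ≤ r * (‖θ‖ ^ 2) ^ 2 * M := by gcongr
      _ = (M * r) * (u ^ 2 + τ ^ 2) ^ 2 := by rw [hn]; ring
      _ ≤ (M * r) * (2 * (u ^ 4 + τ ^ 4)) := by
          gcongr
          nlinarith [sq_nonneg (u ^ 2 - τ ^ 2)]
      _ ≤ _ := by nlinarith [sq_nonneg (u ^ 2), sq_nonneg (τ ^ 2)]
  have h34 : (-(Complex.I * c₃ * θ ^ 3) - c₄ * θ ^ 4).re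
      = c₃ * (3 * u ^ 2 * τ - τ ^ 3) - c₄ * (u ^ 4 - 6 * u ^ 2 * τ ^ 2 + τ ^ 4) := by
    have : -(Complex.I * c₃ * θ ^ 3) - c₄ * θ ^ 4
        = ((c₃ * (3 * u ^ 2 * τ - τ ^ 3) - c₄ * (u ^ 4 - 6 * u ^ 2 * τ ^ 2 + τ ^ 4) : ℝ) : ℂ)
          + ((- c₃ * (u ^ 3 - 3 * u * τ ^ 2) - c₄ * (4 * u ^ 3 * τ - 4 * u * τ ^ 3) : ℝ) : ℂ)
            * Complex.I := by
      rw [hθ]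
      push_cast
      linear_combination (-c₃ * (3 * u ^ 2 * τ + τ ^ 3 * (Complex.I ^ 2 - 1))
        - c₃ * 3 * u * τ ^ 2 * Complex.I
        - c₄ * (6 * u ^ 2 * τ ^ 2 + 4 * u * τ ^ 3 * Complex.I + τ ^ 4 * (Complex.I ^ 2 - 1)) : ℂ)
        * Complex.I_sq
    rw [this, Complex.add_re, Complex.re_ofReal_mul, Complex.I_re, Complex.ofReal_re, mul_zero, add_zero]
  have : 0 ≤ c₄ * τ ^ 4 := by
    have : 0 ≤ c₄ := by nlinarith [norm_nonneg θ, mul_nonneg hM.le ((norm_nonneg θ).trans hr)]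
    positivity
  rw [localExponent, Complex.add_re, h34]
  nlinarith

lemma exists_far_bound {a : ℤ → ℂ} {α c₃ c₄ : ℝ} (ha : DispersiveAssumption a α c₃ c₄)
    {δ : ℝ} (hδ : 0 < δ) :
    ∃ ε κ : ℝ, 0 < ε ∧ 0 < κ ∧ ∀ u τ : ℝ, δ ≤ |u| → |u| ≤ Real.pi → |τ| ≤ ε →
      ‖fourierSymbol a (u + τ * Complex.I)‖ ≤ Real.exp (-(α * τ) - κ) := by
  have hF := (differentiable_fourierSymbol ha.finite_support).continuous
  set g : ℝ × ℝ → ℝ := fun q => ‖fourierSymbol a (q.1 + q.2 * Complex.I)‖ * Real.exp (α * q.2)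
    with hg
  have hgc : Continuous g := by rw [hg]; fun_prop
  set K : Set ℝ := {u | δ ≤ |u|} ∩ Set.Icc (-Real.pi) Real.pi
  have hK : IsCompact K :=
    isCompact_Icc.inter_left (isClosed_le continuous_const continuous_abs)
  have hsub : K ×ˢ ({0} : Set ℝ) ⊆ {q | g q < 1} := by
    rintro ⟨u, τ⟩ ⟨⟨hu1, hu2⟩, hτ⟩
    obtain rfl : τ = 0 := hτ
    have hu0 : u ≠ 0 := by
      rintro rfl
      simp at hu1
      linarith
    simpa [hg] using ha.dissipation u hu2 hu0
  obtain ⟨U, V, -, hV, hKU, h0V, hUV⟩ := generalized_tube_lemma hK isCompact_singleton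
    (isOpen_lt hgc continuous_const) hsub
  obtain ⟨ε, hε, hεV⟩ := Metric.nhds_basis_closedBall.mem_iff.1
    (hV.mem_nhds (h0V (Set.mem_singleton 0)))
  have hc2 : IsCompact (K ×ˢ Metric.closedBall (0 : ℝ) ε) :=
    hK.prod (isCompact_closedBall _ _)
  have hlt : ∀ q ∈ K ×ˢ Metric.closedBall (0 : ℝ) ε, g q < 1 := fun q hq =>
    hUV ⟨hKU hq.1, hεV hq.2⟩
  obtain ⟨m, hm0, hm1, hm⟩ : ∃ m : ℝ, 0 < m ∧ m < 1 ∧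
      ∀ q ∈ K ×ˢ Metric.closedBall (0 : ℝ) ε, g q ≤ m := by
    rcases (K ×ˢ Metric.closedBall (0 : ℝ) ε).eq_empty_or_nonempty with he | hne
    · exact ⟨1 / 2, by norm_num, by norm_num, fun q hq => by simp [he] at hq⟩
    · obtain ⟨q₀, hq₀, hmax⟩ := hc2.exists_isMaxOn hne hgc.continuousOn
      exact ⟨max (g q₀) (1 / 2), by positivity, max_lt (hlt _ hq₀) (by norm_num),
        fun q hq => (hmax hq).trans (le_max_left _ _)⟩
  refine ⟨ε, -Real.log m, hε, neg_pos.2 (Real.log_neg hm0 hm1), fun u τ h1 h2 h3 => ?_⟩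
  have := hm (u, τ) ⟨⟨h1, abs_le.1 h2⟩, by simpa using h3⟩
  rw [sub_neg_eq_add, Real.exp_add, Real.exp_log hm0, Real.exp_neg, inv_mul_eq_div,
    le_div_iff₀ (Real.exp_pos _)]
  exact this

lemma norm_fourierSymbol_eq_of_expansion {a : ℤ → ℂ} {α c₃ c₄ u τ : ℝ} {p : ℂ}
    (h : fourierSymbol a (u + τ * Complex.I) = Complex.exp (Complex.I * α * (u + τ * Complex.I)
      + localExponent c₃ c₄ p (u + τ * Complex.I))) :
    ‖fourierSymbol a (u + τ * Complex.I)‖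
      = Real.exp (-(α * τ) + (localExponent c₃ c₄ p (u + τ * Complex.I)).re) := by
  rw [h, Complex.norm_exp, Complex.add_re]
  congr 2
  simp

/-- Bounds on the symbol on horizontal lines close to the real axis. Below the axis the cubic
dispersion produces Gaussian decay, which also covers the part away from the origin, where the
modulus is at most `e^{-κ}`; above the axis only the loss of a quadratic factor is recorded. -/
lemma exists_symbol_bounds {a : ℤ → ℂ} {α c₃ c₄ : ℝ} (ha : DispersiveAssumption a α c₃ c₄)
    (hc₃ : 0 < c₃) :
    ∃ ε D : ℝ, 0 < ε ∧ 0 < D ∧ ∀ u τ : ℝ, |u| ≤ Real.pi → 0 < τ → τ ≤ ε →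
      ‖fourierSymbol a (u + (-τ : ℝ) * Complex.I)‖
          ≤ Real.exp (α * τ + (c₃ * τ ^ 3 - 2 * c₃ * τ * u ^ 2)) ∧
      ‖fourierSymbol a (u + τ * Complex.I)‖ ≤ Real.exp (-(α * τ) + D * τ ^ 2) := by
  obtain ⟨r₀, M, hr₀, hM, hloc⟩ := exists_local_expansion ha
  have hc₄ := ha.c₄_pos
  -- on the disc of radius `r` the remainder is at most half of the quartic term
  set r := min r₀ (c₄ / (4 * M)) with hr
  have hrpos : 0 < r := lt_min hr₀ (by positivity)
  have hMr : 4 * (M * r) ≤ c₄ := by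
    have : r ≤ c₄ / (4 * M) := min_le_right _ _
    rw [le_div_iff₀ (by positivity)] at this
    linarith
  obtain ⟨ε₁, κ, hε₁, hκ, hfar⟩ := exists_far_bound ha (half_pos hrpos)
  have hpi := Real.pi_pos
  obtain ⟨ε, hε, hle⟩ : ∃ ε : ℝ, 0 < ε ∧ ε ≤ ε₁ ∧ ε ≤ r / 2 ∧ 6 * c₄ * ε ≤ c₃ ∧
      2 * c₃ * Real.pi ^ 2 * ε ≤ κ := by
    -- the last condition makes `e^{-κ}` smaller than the Gaussian factor on the whole period
    refine ⟨min (min ε₁ (r / 2)) (min (c₃ / (6 * c₄)) (κ / (2 * c₃ * Real.pi ^ 2))),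
      by positivity, (min_le_left _ _).trans (min_le_left _ _),
      (min_le_left _ _).trans (min_le_right _ _), ?_, ?_⟩
    · rw [← le_div_iff₀' (by positivity)]
      exact (min_le_right _ _).trans (min_le_left _ _)
    · rw [← le_div_iff₀' (by positivity)]
      exact (min_le_right _ _).trans (min_le_right _ _)
  obtain ⟨hε1, hε2, hε3, hε4⟩ := hle
  refine ⟨ε, (4 * c₃) ^ 2 / (2 * c₄), hε, by positivity, fun u τ hu hτ hτε => ?_⟩
  have hτabs : |τ| = τ := abs_of_pos hτ
  by_cases hnear : |u| ≤ r / 2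
  · have hnorm : ∀ σ : ℝ, |σ| = τ → ‖(u + σ * Complex.I : ℂ)‖ ≤ r := by
      intro σ hσ
      calc ‖(u + σ * Complex.I : ℂ)‖ ≤ ‖(u : ℂ)‖ + ‖(σ * Complex.I : ℂ)‖ := norm_add_le _ _
        _ = |u| + τ := by simp [hσ]
        _ ≤ r := by linarith
    have hr' : r ≤ r₀ := min_le_left _ _
    have h4 : 0 ≤ u ^ 4 := by positivity
    have hτu : 6 * c₄ * τ * (u ^ 2 * τ) ≤ c₃ * (u ^ 2 * τ) := by
      gcongr
      nlinarith
    constructor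
    · have hn := hnorm (-τ) (by rw [abs_neg, hτabs])
      obtain ⟨p, hp, h⟩ := hloc _ (hn.trans hr')
      rw [norm_fourierSymbol_eq_of_expansion h]
      have := re_localExponent_le (c₃ := c₃) hM hp hn hMr
      apply Real.exp_le_exp.2
      nlinarith
    · have hn := hnorm τ hτabs
      obtain ⟨p, hp, h⟩ := hloc _ (hn.trans hr')
      rw [norm_fourierSymbol_eq_of_expansion h]
      have := re_localExponent_le (c₃ := c₃) hM hp hn hMr
      apply Real.exp_le_exp.2
      -- completing the square in `u ^ 2`
      have hsq : 4 * c₃ * (u ^ 2 * τ) - c₄ / 2 * u ^ 4 ≤ (4 * c₃) ^ 2 / (2 * c₄) * τ ^ 2 := by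
        have e : (4 * c₃) ^ 2 / (2 * c₄) * τ ^ 2 - (4 * c₃ * (u ^ 2 * τ) - c₄ / 2 * u ^ 4)
            = (c₄ * u ^ 2 - 4 * c₃ * τ) ^ 2 / (2 * c₄) := by
          field_simp; ring
        have : 0 ≤ (c₄ * u ^ 2 - 4 * c₃ * τ) ^ 2 / (2 * c₄) := by positivity
        linarith
      have : 0 ≤ c₃ * τ ^ 3 := by positivity
      nlinarith
  · push Not at hnear
    have hu2 : u ^ 2 ≤ Real.pi ^ 2 := by
      rw [← sq_abs u]; gcongr
    constructor
    · refine (hfar u (-τ) hnear.le hu (by rw [abs_neg, hτabs]; linarith)).trans ?_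
      apply Real.exp_le_exp.2
      have h1 : 2 * c₃ * τ * u ^ 2 ≤ 2 * c₃ * ε * Real.pi ^ 2 := by gcongr
      have : 0 ≤ c₃ * τ ^ 3 := by positivity
      nlinarith
    · refine (hfar u τ hnear.le hu (by rw [hτabs]; linarith)).trans ?_
      apply Real.exp_le_exp.2
      have : 0 ≤ (4 * c₃) ^ 2 / (2 * c₄) * τ ^ 2 := by positivity
      linarith

lemma norm_greenIntegrand (a : ℤ → ℂ) (n : ℕ) (j : ℤ) (u τ : ℝ) :
    ‖greenIntegrand a n j (u + τ * Complex.I)‖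
      = ‖fourierSymbol a (u + τ * Complex.I)‖ ^ n * Real.exp (j * τ) := by
  rw [greenIntegrand, norm_mul, norm_pow, Complex.norm_exp]
  congr 3
  simp

lemma norm_greenIntegrand_le {a : ℤ → ℂ} {α u τ q : ℝ} (n : ℕ) (j : ℤ)
    (h : ‖fourierSymbol a (u + τ * Complex.I)‖ ≤ Real.exp (-(α * τ) + q)) :
    ‖greenIntegrand a n j (u + τ * Complex.I)‖ ≤ Real.exp ((j - α * n) * τ + n * q) := by
  rw [norm_greenIntegrand]
  calc _ ≤ Real.exp (-(α * τ) + q) ^ n * Real.exp (j * τ) := by gcongr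
    _ = _ := by
      rw [← Real.exp_nat_mul, ← Real.exp_add]; congr 1; ring

/-- Gaussian bound for the integrand on the line `Im θ = -τ`, and a bound on `Im θ = τ` in which the
factor `e^{xτ}` wins as soon as `-x` is comparable to `n`. -/
lemma exists_norm_greenIntegrand_le {a : ℤ → ℂ} {α c₃ c₄ : ℝ}
    (ha : DispersiveAssumption a α c₃ c₄) (hc₃ : 0 < c₃) :
    ∃ ε D : ℝ, 0 < ε ∧ 0 < D ∧ ∀ (n : ℕ) (j : ℤ) (u τ : ℝ), |u| ≤ Real.pi → 0 < τ → τ ≤ ε →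
      ‖greenIntegrand a n j (u + (-τ : ℝ) * Complex.I)‖
          ≤ Real.exp (-((j - α * n) * τ) + n * (c₃ * τ ^ 3 - 2 * c₃ * τ * u ^ 2)) ∧
      ‖greenIntegrand a n j (u + τ * Complex.I)‖
          ≤ Real.exp ((j - α * n) * τ + n * (D * τ ^ 2)) := by
  obtain ⟨ε, D, hε, hD, h⟩ := exists_symbol_bounds ha hc₃
  refine ⟨ε, D, hε, hD, fun n j u τ hu hτ hτε => ?_⟩
  obtain ⟨h1, h2⟩ := h u τ hu hτ hτε
  refine ⟨?_, norm_greenIntegrand_le n j h2⟩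
  have := norm_greenIntegrand_le (a := a) (α := α) (u := u) (τ := -τ)
    (q := c₃ * τ ^ 3 - 2 * c₃ * τ * u ^ 2) n j (by rw [mul_neg, neg_neg]; exact h1)
  rwa [mul_neg] at this

/-! ### The Green's function outside the oscillatory region -/

/-- Decay at scale `n ^ (1/3)` on the non-oscillatory side, including the Airy transition layer. -/
lemma exists_greenFn_bound_right {a : ℤ → ℂ} {α c₃ c₄ : ℝ}
    (ha : DispersiveAssumption a α c₃ c₄) (hc₃ : 0 < c₃) :
    ∃ C : ℝ, 0 < C ∧ ∀ (n : ℕ) (j : ℤ) (N : ℝ), 1 ≤ N → N ^ 3 = n → -N ≤ j - α * n →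
      ‖greenFn a n j‖ ≤ C * decayProfile N |j - α * n| := by
  obtain ⟨ε, D, hε, -, h⟩ := exists_norm_greenIntegrand_le ha hc₃
  obtain ⟨C, hC, hexp⟩ := exists_exp_le_decayProfile hε 0
  have hpi := Real.pi_pos
  set B := Real.exp (2 * ε + c₃ * ε ^ 3) * √(Real.pi / (2 * c₃ * ε))
  refine ⟨B * C / (2 * Real.pi), by positivity, fun n j N hN hNn hx => ?_⟩
  have hN0 : 0 < N := by linarith
  set x : ℝ := j - α * n
  have hG : ‖(2 * Real.pi * greenFn a n j : ℂ)‖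
      ≤ Real.exp (-(x * (ε / N)) + c₃ * ε ^ 3) * √(Real.pi / (2 * c₃ * ε * N ^ 2)) := by
    rw [two_pi_mul_greenFn ha.finite_support (-(ε / N))]
    refine norm_integral_le_of_le_gaussian (by positivity) (by linarith) (Real.exp_pos _).le
      fun u hu => ?_
    refine (h n j u (ε / N) (abs_le.2 hu) (by positivity) (div_le_self hε.le hN)).1.trans ?_
    rw [← Real.exp_add]
    apply Real.exp_le_exp.2
    apply le_of_eq
    simp only [x, ← hNn]
    field_simp
    ring
  have h1 : √(Real.pi / (2 * c₃ * ε * N ^ 2)) = √(Real.pi / (2 * c₃ * ε)) / N := by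
    rw [← div_div, Real.sqrt_div (by positivity), Real.sqrt_sq hN0.le]
  have h2 : -(x * (ε / N)) ≤ 2 * ε + -(ε * (|x| / N)) := by
    have : |x| - x ≤ 2 * N := by
      rcases abs_cases x with h | h <;> linarith
    have h3 : (|x| - x) * (ε / N) ≤ 2 * N * (ε / N) := by gcongr
    have h4 : 2 * N * (ε / N) = 2 * ε := by field_simp
    have h5 : |x| * (ε / N) = ε * (|x| / N) := by ring
    linarith
  have h3 := hexp N |x| hN0 (abs_nonneg x)
  rw [pow_zero, one_mul] at h3
  rw [norm_mul, norm_mul, Complex.norm_ofNat, Complex.norm_real, Real.norm_of_nonneg hpi.le] at hG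
  rw [div_mul_eq_mul_div, le_div_iff₀' (by positivity)]
  refine hG.trans ?_
  rw [h1]
  calc _ ≤ Real.exp (2 * ε + -(ε * (|x| / N)) + c₃ * ε ^ 3) * (√(Real.pi / (2 * c₃ * ε)) / N) := by
        gcongr
    _ = B * (Real.exp (-(ε * (|x| / N))) / N) := by
        rw [show 2 * ε + -(ε * (|x| / N)) + c₃ * ε ^ 3 = (2 * ε + c₃ * ε ^ 3) + -(ε * (|x| / N)) by
          ring, Real.exp_add]
        ring
    _ ≤ B * (C * decayProfile N |x|) := by gcongr
    _ = _ := by ring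

/-- Exponential decay far on the oscillatory side. -/
lemma exists_greenFn_bound_far_left {a : ℤ → ℂ} {α c₃ c₄ : ℝ}
    (ha : DispersiveAssumption a α c₃ c₄) (hc₃ : 0 < c₃) {ρ : ℝ} (hρ : 0 < ρ) :
    ∃ C : ℝ, 0 < C ∧ ∀ (n : ℕ) (j : ℤ), j - α * n ≤ -(ρ * n) →
      ‖greenFn a n j‖ ≤ C * decayProfile 1 |j - α * n| := by
  obtain ⟨ε, D, hε, hD, h⟩ := exists_norm_greenIntegrand_le ha hc₃
  set τ := min ε (ρ / (2 * D))
  have hτ : 0 < τ := by positivity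
  have hτD : D * τ ≤ ρ / 2 := by
    have : τ ≤ ρ / (2 * D) := min_le_right _ _
    rw [le_div_iff₀ (by positivity)] at this
    linarith
  obtain ⟨C, hC, hexp⟩ := exists_exp_le_decayProfile (half_pos hτ) 0
  have hpi := Real.pi_pos
  refine ⟨C, hC, fun n j hx => ?_⟩
  have hx0 : (j : ℝ) - α * n ≤ 0 := hx.trans (by simp; positivity)
  have h3 := hexp 1 |j - α * n| one_pos (abs_nonneg _)
  refine le_trans ?_ h3
  rw [pow_zero, one_mul, div_one, div_one, abs_of_nonpos hx0]
  have hG : ‖(2 * Real.pi * greenFn a n j : ℂ)‖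
      ≤ Real.exp (-(τ / 2 * -(j - α * n))) * |Real.pi - -Real.pi| := by
    rw [two_pi_mul_greenFn ha.finite_support τ]
    refine intervalIntegral.norm_integral_le_of_norm_le_const fun u hu => ?_
    rw [Set.uIoc_of_le (by linarith)] at hu
    refine (h n j u τ (abs_le.2 ⟨hu.1.le, hu.2⟩) hτ (min_le_left _ _)).2.trans ?_
    apply Real.exp_le_exp.2
    have h1 : n * τ * (D * τ) ≤ n * τ * (ρ / 2) := by gcongr
    nlinarith
  rw [norm_mul, norm_mul, Complex.norm_ofNat, Complex.norm_real, Real.norm_of_nonneg hpi.le,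
    sub_neg_eq_add, ← two_mul, abs_of_pos (by positivity), mul_comm (Real.exp _)] at hG
  exact le_of_mul_le_mul_left hG (by positivity)

/-! ### Saddle point expansion -/

/-- Value of the exponent at the saddle point `η`, with the analytic remainder left out. -/
noncomputable def saddleValue (c₃ c₄ ν η : ℝ) : ℂ :=
  Complex.I * (2 * c₃ * ν * η ^ 3 : ℝ) - (c₄ * ν * η ^ 4 : ℝ)

/-- Cubic Taylor term of the exponent at the saddle point `η` in the direction `1 - i`. -/
noncomputable def saddleCubic (c₃ ν t : ℝ) : ℂ :=
  c₃ * ν * (-2 + 2 * Complex.I) * t ^ 3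

lemma saddle_exponent_eq (c₃ c₄ ν η t : ℝ) (p : ℂ) :
    Complex.I * (3 * c₃ * ν * η ^ 2 : ℝ) * (η + t * (1 - Complex.I))
        + ν * localExponent c₃ c₄ p (η + t * (1 - Complex.I))
      = saddleValue c₃ c₄ ν η + (-(6 * (c₃ * ν * η)) * t ^ 2 : ℝ) + (saddleCubic c₃ ν t
        + ν * ((η + t * (1 - Complex.I)) ^ 5 * p
          - c₄ * ((η + t * (1 - Complex.I)) ^ 4 - η ^ 4))) := by
  have hw : (1 - Complex.I) ^ 2 = -2 * Complex.I := by
    linear_combination Complex.I_sq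
  unfold localExponent saddleValue saddleCubic
  push_cast
  linear_combination (-Complex.I * c₃ * ν * (3 * η * t ^ 2 + t ^ 3 * (1 - Complex.I))) * hw
    + (6 * c₃ * ν * η * t ^ 2 + 2 * c₃ * ν * t ^ 3 * (1 - Complex.I)) * Complex.I_sq

lemma norm_one_sub_I_le : ‖(1 - Complex.I : ℂ)‖ ≤ 3 / 2 := by
  rw [Complex.norm_def, Real.sqrt_le_left (by norm_num)]
  simp [Complex.normSq_apply]
  norm_num

lemma norm_saddleCubic_le {c₃ ν η t : ℝ} (hc₃ : 0 < c₃) (hν : 0 < ν) (ht : |t| ≤ η) :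
    ‖saddleCubic c₃ ν t‖ ≤ 3 * (c₃ * ν * η) * t ^ 2 ∧
      ‖saddleCubic c₃ ν t‖ ^ 2 ≤ 9 * (c₃ * ν) ^ 2 * t ^ 6 := by
  have h1 : ‖saddleCubic c₃ ν t‖ ≤ 3 * (c₃ * ν) * |t| ^ 3 := by
    have : saddleCubic c₃ ν t = c₃ * ν * (-2 * (1 - Complex.I)) * t ^ 3 := by
      unfold saddleCubic; ring
    rw [this]
    simp only [norm_mul, norm_pow, norm_neg, Complex.norm_ofNat, Complex.norm_real, Real.norm_eq_abs,
      abs_of_pos hc₃, abs_of_pos hν]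
    calc _ ≤ c₃ * ν * (2 * (3 / 2)) * |t| ^ 3 := by gcongr; exact norm_one_sub_I_le
      _ = _ := by ring
  constructor
  · calc _ ≤ _ := h1
      _ = 3 * (c₃ * ν) * |t| ^ 2 * |t| := by ring
      _ ≤ 3 * (c₃ * ν) * |t| ^ 2 * η := by gcongr
      _ = _ := by rw [sq_abs]; ring
  · calc _ ≤ (3 * (c₃ * ν) * |t| ^ 3) ^ 2 := by gcongr
      _ = 9 * (c₃ * ν) ^ 2 * (|t| ^ 2) ^ 3 := by ring
      _ = _ := by rw [sq_abs]; ring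

lemma norm_saddle_remainder_le {c₄ M ν η t : ℝ} {p : ℂ} (hc₄ : 0 < c₄)
    (hν : 0 < ν) (ht : |t| ≤ η) (hp : ‖p‖ ≤ M) :
    ‖(ν * ((η + t * (1 - Complex.I)) ^ 5 * p
          - c₄ * ((η + t * (1 - Complex.I)) ^ 4 - η ^ 4)) : ℂ)‖
      ≤ ν * (60 * c₄ * |t| * η ^ 3 + 243 * M * η ^ 5) := by
  have hη : 0 ≤ η := (abs_nonneg t).trans ht
  have hv : ‖(t * (1 - Complex.I) : ℂ)‖ ≤ 3 / 2 * |t| := by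
    rw [norm_mul, Complex.norm_real, Real.norm_eq_abs, mul_comm]
    gcongr
    exact norm_one_sub_I_le
  set θ : ℂ := η + t * (1 - Complex.I) with hθ
  have hηn : ‖(η : ℂ)‖ = η := by rw [Complex.norm_real, Real.norm_of_nonneg hη]
  have hθn : ‖θ‖ ≤ 3 * η := by
    calc ‖θ‖ ≤ ‖(η : ℂ)‖ + ‖(t * (1 - Complex.I) : ℂ)‖ := norm_add_le _ _
      _ ≤ 3 * η := by rw [hηn]; linarith
  have h4 : ‖θ ^ 4 - (η : ℂ) ^ 4‖ ≤ 60 * |t| * η ^ 3 := by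
    have e : θ ^ 4 - (η : ℂ) ^ 4
        = (t * (1 - Complex.I)) * (θ ^ 3 + θ ^ 2 * η + θ * η ^ 2 + η ^ 3) := by
      have : (t * (1 - Complex.I) : ℂ) = θ - η := by rw [hθ]; ring
      rw [this]; ring
    have h : ‖θ ^ 3 + θ ^ 2 * η + θ * (η : ℂ) ^ 2 + (η : ℂ) ^ 3‖ ≤ 40 * η ^ 3 := by
      calc _ ≤ ‖θ‖ ^ 3 + ‖θ‖ ^ 2 * η + ‖θ‖ * η ^ 2 + η ^ 3 := by
            refine (norm_add_le _ _).trans (add_le_add ((norm_add_le _ _).trans (add_le_add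
              ((norm_add_le _ _).trans (add_le_add ?_ ?_)) ?_)) ?_) <;>
            simp [abs_of_nonneg hη]
        _ ≤ (3 * η) ^ 3 + (3 * η) ^ 2 * η + (3 * η) * η ^ 2 + η ^ 3 := by gcongr
        _ = _ := by ring
    rw [e, norm_mul]
    calc _ ≤ (3 / 2 * |t|) * (40 * η ^ 3) := by gcongr
      _ = _ := by ring
  rw [norm_mul, Complex.norm_real, Real.norm_of_nonneg hν.le]
  gcongr
  calc _ ≤ ‖θ ^ 5 * p‖ + ‖(c₄ * (θ ^ 4 - η ^ 4) : ℂ)‖ := norm_sub_le _ _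
    _ ≤ (3 * η) ^ 5 * M + c₄ * (60 * |t| * η ^ 3) := by
        rw [norm_mul, norm_pow, norm_mul, Complex.norm_real, Real.norm_of_nonneg hc₄.le]
        gcongr
    _ = _ := by ring

lemma norm_exp_add_sub_one_add_le (Z R : ℂ) :
    ‖Complex.exp (Z + R) - (1 + Z)‖ ≤ (‖R‖ * Real.exp ‖R‖ + ‖Z‖ ^ 2) * Real.exp ‖Z‖ := by
  have h1 := Complex.norm_exp_sub_sum_le_norm_mul_exp R 1
  have h2 := Complex.norm_exp_sub_sum_le_norm_mul_exp Z 2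
  simp only [Finset.sum_range_succ, Finset.sum_range_zero, pow_zero, pow_one, zero_add,
    Nat.factorial, Nat.cast_one, div_one, mul_one] at h1 h2
  have h3 : ‖Complex.exp Z‖ ≤ Real.exp ‖Z‖ := by
    rw [Complex.norm_exp]; exact Real.exp_le_exp.2 (Complex.re_le_norm Z)
  have e : Complex.exp (Z + R) - (1 + Z)
      = Complex.exp Z * (Complex.exp R - 1) + (Complex.exp Z - (1 + Z)) := by
    rw [Complex.exp_add]; ring
  rw [e]
  calc _ ≤ ‖Complex.exp Z * (Complex.exp R - 1)‖ + ‖Complex.exp Z - (1 + Z)‖ := norm_add_le _ _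
    _ ≤ Real.exp ‖Z‖ * (‖R‖ * Real.exp ‖R‖) + ‖Z‖ ^ 2 * Real.exp ‖Z‖ := by
        rw [norm_mul]
        refine add_le_add (mul_le_mul h3 h1 (norm_nonneg _) (Real.exp_pos _).le) ?_
        simpa using h2
    _ = _ := by ring

lemma pow_three_mul_exp_neg_le {s : ℝ} (hs : 0 ≤ s) : s ^ 3 * Real.exp (-s) ≤ 6 := by
  have h := Real.pow_div_factorial_le_exp s hs 3
  rw [Real.exp_neg, ← div_eq_mul_inv, div_le_iff₀ (Real.exp_pos _)]
  simp [Nat.factorial] at h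
  linarith

lemma abs_mul_exp_neg_le {K : ℝ} (hK : 0 < K) (t : ℝ) :
    |t| * Real.exp (-(K * t ^ 2)) ≤ 1 / √K := by
  have hK' := Real.sqrt_pos.2 hK
  rw [le_div_iff₀ hK', Real.exp_neg, ← div_eq_mul_inv, div_mul_eq_mul_div,
    div_le_one (Real.exp_pos _)]
  have h := Real.add_one_le_exp (K * t ^ 2)
  have : (|t| * √K) ^ 2 = K * t ^ 2 := by rw [mul_pow, sq_abs, Real.sq_sqrt hK.le]; ring
  nlinarith [sq_nonneg (|t| * √K - 1)]

/-- Second-order Taylor expansion at the saddle point along the steepest-descent direction. The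
cubic term is kept: its integral vanishes by oddness, whereas its absolute value would cost a
logarithm after summation over the lattice. -/
lemma norm_saddle_expansion_le {c₃ c₄ M ν η t : ℝ} {p : ℂ} (hc₃ : 0 < c₃) (hc₄ : 0 < c₄)
    (hM : 0 < M) (hν : 0 < ν) (hη : 0 < η) (ht : |t| ≤ η) (hp : ‖p‖ ≤ M)
    (hsmall : (900 * c₄ ^ 2 / c₃ + 243 * M) * η ≤ c₄ / 2) :
    ‖Complex.exp (Complex.I * (3 * c₃ * ν * η ^ 2 : ℝ) * (η + t * (1 - Complex.I))
        + ν * localExponent c₃ c₄ p (η + t * (1 - Complex.I)))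
      - Complex.exp (saddleValue c₃ c₄ ν η + (-(6 * (c₃ * ν * η)) * t ^ 2 : ℝ))
        * (1 + saddleCubic c₃ ν t)‖
      ≤ (60 * c₄ * ν * η ^ 3 / √(c₃ * ν * η) * Real.exp (-(c₄ / 2 * (ν * η ^ 4)))
          + 54 * (c₃ * ν) ^ 2 / (c₃ * ν * η) ^ 3) * Real.exp (-(c₃ * ν * η) * t ^ 2)
        + 243 * M * ν * η ^ 5 * Real.exp (-(c₄ / 2 * (ν * η ^ 4))) := by
  obtain ⟨hZ1, hZ2⟩ := norm_saddleCubic_le hc₃ hν ht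
  have hR1 := norm_saddle_remainder_le hc₄ hν ht hp
  rw [saddle_exponent_eq, Complex.exp_add, ← mul_sub, norm_mul]
  generalize (ν * ((η + t * (1 - Complex.I)) ^ 5 * p
          - c₄ * ((η + t * (1 - Complex.I)) ^ 4 - η ^ 4)) : ℂ) = R at *
  generalize saddleCubic c₃ ν t = Z at *
  set K := c₃ * ν * η with hK
  have hKpos : 0 < K := by positivity
  have hA : ‖Complex.exp (saddleValue c₃ c₄ ν η + (-(6 * K) * t ^ 2 : ℝ))‖
      = Real.exp (-(c₄ * (ν * η ^ 4)) - 6 * K * t ^ 2) := by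
    rw [Complex.norm_exp]
    congr 1
    rw [saddleValue, Complex.add_re, Complex.sub_re, Complex.I_mul_re, Complex.ofReal_re,
      Complex.ofReal_re, Complex.ofReal_im]
    ring
  -- by the arithmetic-geometric mean inequality `R` is absorbed by the Gaussian and the dissipation
  have hR2 : ‖R‖ ≤ K * t ^ 2 + c₄ / 2 * (ν * η ^ 4) := by
    have h1 : 60 * c₄ * |t| * η ^ 3 ≤ c₃ * η * t ^ 2 + 900 * c₄ ^ 2 / c₃ * η ^ 5 := by
      have e : c₃ * η * t ^ 2 + 900 * c₄ ^ 2 / c₃ * η ^ 5 - 60 * c₄ * |t| * η ^ 3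
          = η / c₃ * (c₃ * |t| - 30 * c₄ * η ^ 2) ^ 2 := by
        rw [← sq_abs t]; field_simp; ring
      have : 0 ≤ η / c₃ * (c₃ * |t| - 30 * c₄ * η ^ 2) ^ 2 := by positivity
      linarith
    calc ‖R‖ ≤ _ := hR1
      _ ≤ ν * (c₃ * η * t ^ 2 + 900 * c₄ ^ 2 / c₃ * η ^ 5 + 243 * M * η ^ 5) := by gcongr
      _ = K * t ^ 2 + ((900 * c₄ ^ 2 / c₃ + 243 * M) * η) * (ν * η ^ 4) := by rw [hK]; ring
      _ ≤ _ := by gcongr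
  have hexpR : Real.exp (-(c₄ * (ν * η ^ 4)) - 6 * K * t ^ 2) * (Real.exp ‖R‖ * Real.exp ‖Z‖)
      ≤ Real.exp (-(c₄ / 2 * (ν * η ^ 4))) * Real.exp (-(2 * K * t ^ 2)) := by
    rw [← Real.exp_add, ← Real.exp_add, ← Real.exp_add]
    apply Real.exp_le_exp.2
    linarith
  have hexpZ : Real.exp (-(c₄ * (ν * η ^ 4)) - 6 * K * t ^ 2) * Real.exp ‖Z‖
      ≤ Real.exp (-(2 * K * t ^ 2)) := by
    rw [← Real.exp_add]
    apply Real.exp_le_exp.2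
    have : 0 ≤ c₄ * (ν * η ^ 4) := by positivity
    have : 0 ≤ K * t ^ 2 := by positivity
    linarith
  have hsplit : Real.exp (-(2 * K * t ^ 2))
      = Real.exp (-(K * t ^ 2)) * Real.exp (-K * t ^ 2) := by
    rw [← Real.exp_add]; congr 1; ring
  have hle1 : Real.exp (-(2 * K * t ^ 2)) ≤ 1 := by
    rw [Real.exp_le_one_iff]
    have : 0 ≤ K * t ^ 2 := by positivity
    linarith
  set G := Real.exp (-(c₄ / 2 * (ν * η ^ 4)))
  have hG : 0 < G := Real.exp_pos _
  rw [hA]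
  calc _ ≤ Real.exp (-(c₄ * (ν * η ^ 4)) - 6 * K * t ^ 2)
        * ((‖R‖ * Real.exp ‖R‖ + ‖Z‖ ^ 2) * Real.exp ‖Z‖) := by
        gcongr
        exact norm_exp_add_sub_one_add_le Z R
    _ = ‖R‖ * (Real.exp (-(c₄ * (ν * η ^ 4)) - 6 * K * t ^ 2) * (Real.exp ‖R‖ * Real.exp ‖Z‖))
        + ‖Z‖ ^ 2 * (Real.exp (-(c₄ * (ν * η ^ 4)) - 6 * K * t ^ 2) * Real.exp ‖Z‖) := by ring
    _ ≤ (ν * (60 * c₄ * |t| * η ^ 3 + 243 * M * η ^ 5)) * (G * Real.exp (-(2 * K * t ^ 2)))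
        + (9 * (c₃ * ν) ^ 2 * t ^ 6) * Real.exp (-(2 * K * t ^ 2)) := by gcongr
    _ = (60 * c₄ * ν * η ^ 3 * G * (|t| * Real.exp (-(K * t ^ 2)))
          + 9 * (c₃ * ν) ^ 2 / K ^ 3 * ((K * t ^ 2) ^ 3 * Real.exp (-(K * t ^ 2))))
            * Real.exp (-K * t ^ 2)
        + 243 * M * ν * η ^ 5 * G * Real.exp (-(2 * K * t ^ 2)) := by
        rw [hsplit]; field_simp; ring
    _ ≤ (60 * c₄ * ν * η ^ 3 * G * (1 / √K) + 9 * (c₃ * ν) ^ 2 / K ^ 3 * 6)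
            * Real.exp (-K * t ^ 2)
        + 243 * M * ν * η ^ 5 * G * 1 := by
        gcongr
        · exact abs_mul_exp_neg_le hKpos t
        · exact pow_three_mul_exp_neg_le (by positivity)
    _ = _ := by ring

lemma integral_saddle_main (c₃ c₄ ν η : ℝ) :
    ∫ t in (-η)..η, Complex.exp (saddleValue c₃ c₄ ν η + (-(6 * (c₃ * ν * η)) * t ^ 2 : ℝ))
        * (1 + saddleCubic c₃ ν t)
      = Complex.exp (saddleValue c₃ c₄ ν η)
        * (∫ t in (-η)..η, Real.exp (-(6 * (c₃ * ν * η)) * t ^ 2) : ℝ) := by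
  set b := 6 * (c₃ * ν * η)
  set A := saddleValue c₃ c₄ ν η
  have hodd : ∫ t in (-η)..η, (Real.exp (-b * t ^ 2) : ℂ) * saddleCubic c₃ ν t = 0 := by
    have h := intervalIntegral.integral_comp_neg (a := -η) (b := η)
      (fun t => (Real.exp (-b * t ^ 2) : ℂ) * saddleCubic c₃ ν t)
    have e : ∀ t : ℝ, (Real.exp (-b * (-t) ^ 2) : ℂ) * saddleCubic c₃ ν (-t)
        = -((Real.exp (-b * t ^ 2) : ℂ) * saddleCubic c₃ ν t) := by
      intro t
      rw [neg_sq]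
      unfold saddleCubic
      push_cast
      ring
    simp_rw [e] at h
    rw [intervalIntegral.integral_neg, neg_neg] at h
    exact self_eq_neg.1 h.symm
  have e : ∀ t : ℝ, Complex.exp (A + (-b * t ^ 2 : ℝ)) * (1 + saddleCubic c₃ ν t)
      = Complex.exp A * ((Real.exp (-b * t ^ 2) : ℂ)
        + (Real.exp (-b * t ^ 2) : ℂ) * saddleCubic c₃ ν t) := by
    intro t
    rw [Complex.exp_add, Complex.ofReal_exp]; ring
  simp_rw [e]
  rw [intervalIntegral.integral_const_mul, intervalIntegral.integral_add, hodd, add_zero,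
    intervalIntegral.integral_ofReal]
  · exact Continuous.intervalIntegrable (by fun_prop) _ _
  · refine Continuous.intervalIntegrable ?_ _ _
    unfold saddleCubic
    fun_prop

/-- Contribution of one steepest-descent segment. -/
lemma norm_integral_saddle_sub_le {f : ℝ → ℂ} {c₃ c₄ M ν η : ℝ} (hc₃ : 0 < c₃)
    (hc₄ : 0 < c₄) (hM : 0 < M) (hν : 0 < ν) (hη : 0 < η)
    (hsmall : (900 * c₄ ^ 2 / c₃ + 243 * M) * η ≤ c₄ / 2) (hfc : Continuous f)
    (hf : ∀ t : ℝ, |t| ≤ η → ∃ p : ℂ, ‖p‖ ≤ M ∧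
      f t = Complex.exp (Complex.I * (3 * c₃ * ν * η ^ 2 : ℝ) * (η + t * (1 - Complex.I))
        + ν * localExponent c₃ c₄ p (η + t * (1 - Complex.I)))) :
    ‖(∫ t in (-η)..η, f t) - Complex.exp (saddleValue c₃ c₄ ν η)
        * (∫ t in (-η)..η, Real.exp (-(6 * (c₃ * ν * η)) * t ^ 2) : ℝ)‖
      ≤ (60 * c₄ * ν * η ^ 3 / √(c₃ * ν * η) * Real.exp (-(c₄ / 2 * (ν * η ^ 4)))
          + 54 * (c₃ * ν) ^ 2 / (c₃ * ν * η) ^ 3) * √(Real.pi / (c₃ * ν * η))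
        + (η - -η) * (243 * M * ν * η ^ 5 * Real.exp (-(c₄ / 2 * (ν * η ^ 4)))) := by
  rw [← integral_saddle_main, ← intervalIntegral.integral_sub]
  · refine norm_integral_le_of_le_gaussian_add (by positivity) (by linarith) (by positivity)
      fun t ht => ?_
    obtain ⟨p, hp, h⟩ := hf t (abs_le.2 ht)
    rw [h]
    exact norm_saddle_expansion_le hc₃ hc₄ hM hν hη (abs_le.2 ht) hp hsmall
  · exact hfc.intervalIntegrable _ _
  · refine Continuous.intervalIntegrable ?_ _ _
    unfold saddleCubic
    fun_prop

lemma greenIntegrand_eq_exp {a : ℤ → ℂ} {α c₃ c₄ : ℝ} {θ p : ℂ} (n : ℕ) (j : ℤ)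
    (h : fourierSymbol a θ = Complex.exp (Complex.I * α * θ + localExponent c₃ c₄ p θ)) :
    greenIntegrand a n j θ
      = Complex.exp (Complex.I * (-(j - α * n) : ℝ) * θ + (n : ℝ) * localExponent c₃ c₄ p θ) := by
  rw [greenIntegrand, h, ← Complex.exp_nat_mul, ← Complex.exp_add]
  congr 1
  push_cast
  ring

/-- The reflection `θ ↦ -conj θ` exchanges the two saddle points and conjugates the integrand. -/
lemma conj_exp_reflect (c₃ c₄ y ν : ℝ) (p θ : ℂ) :
    conj (Complex.exp (Complex.I * y * (-conj θ) + ν * localExponent c₃ c₄ p (-conj θ)))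
      = Complex.exp (Complex.I * y * θ + ν * localExponent c₃ c₄ (-conj p) θ) := by
  rw [← Complex.exp_conj]
  congr 1
  simp only [localExponent, map_add, map_sub, map_mul, map_neg, map_pow, Complex.conj_conj,
    Complex.conj_I, Complex.conj_ofReal]
  ring

lemma saddleValue_main_add_conj (c₃ c₄ ν η J : ℝ) :
    Complex.exp (saddleValue c₃ c₄ ν η) * J * (1 - Complex.I)
        + conj (Complex.exp (saddleValue c₃ c₄ ν η) * J * (1 - Complex.I))
      = ((2 * Real.exp (-(c₄ * ν * η ^ 4)) * Real.cos (2 * c₃ * ν * η ^ 3 - Real.pi / 4)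
        * (√2 * J) : ℝ) : ℂ) := by
  rw [Complex.add_conj]
  congr 1
  have h : Complex.exp (saddleValue c₃ c₄ ν η) = (Real.exp (-(c₄ * ν * η ^ 4)) : ℂ)
      * (Real.cos (2 * c₃ * ν * η ^ 3) + Real.sin (2 * c₃ * ν * η ^ 3) * Complex.I) := by
    rw [Complex.ofReal_exp, Complex.ofReal_cos, Complex.ofReal_sin, ← Complex.exp_mul_I,
      ← Complex.exp_add, saddleValue]
    congr 1
    push_cast
    ring
  have e : (Real.exp (-(c₄ * ν * η ^ 4)) : ℂ)
      * (Real.cos (2 * c₃ * ν * η ^ 3) + Real.sin (2 * c₃ * ν * η ^ 3) * Complex.I) * J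
        * (1 - Complex.I)
      = ((Real.exp (-(c₄ * ν * η ^ 4)) * J
          * (Real.cos (2 * c₃ * ν * η ^ 3) + Real.sin (2 * c₃ * ν * η ^ 3)) : ℝ) : ℂ)
        + ((Real.exp (-(c₄ * ν * η ^ 4)) * J
          * (Real.sin (2 * c₃ * ν * η ^ 3) - Real.cos (2 * c₃ * ν * η ^ 3)) : ℝ) : ℂ)
          * Complex.I := by
    push_cast
    linear_combination (-Complex.exp (-(c₄ * ν * η ^ 4)) * J * Complex.sin (2 * c₃ * ν * η ^ 3))
      * Complex.I_sq
  rw [h, e, Complex.add_re, Complex.re_ofReal_mul, Complex.I_re, Complex.ofReal_re, mul_zero,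
    add_zero, Real.cos_sub, Real.cos_pi_div_four, Real.sin_pi_div_four]
  have h2 : √2 * √2 = 2 := Real.mul_self_sqrt (by norm_num)
  linear_combination (-Real.exp (-(c₄ * ν * η ^ 4)) * J
    * (Real.cos (2 * c₃ * ν * η ^ 3) + Real.sin (2 * c₃ * ν * η ^ 3))) * h2

/-- The approximate Green's function in terms of the modulus `η` of the saddle points. -/
lemma two_pi_mul_approxGreenFn {α c₃ c₄ : ℝ} (hc₃ : 0 < c₃) {n : ℕ} (hn : 1 ≤ n) {j : ℤ} {η : ℝ}
    (hη : 0 < η) (hx : (j : ℝ) - α * n = -(3 * c₃ * n * η ^ 2)) :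
    2 * Real.pi * approxGreenFn α c₃ c₄ n j
      = 2 * Real.exp (-(c₄ * n * η ^ 4)) * Real.cos (2 * c₃ * n * η ^ 3 - Real.pi / 4)
        * (√2 * ∫ t in (-η)..η, Real.exp (-(6 * (c₃ * n * η)) * t ^ 2)) := by
  have hn0 : (0 : ℝ) < n := by exact_mod_cast hn
  have hpos : 0 < 3 * c₃ * n * η ^ 2 := by positivity
  unfold approxGreenFn
  rw [hx, abs_neg, abs_of_pos hpos]
  set S := √(3 * c₃ * n)
  have hSpos : 0 < S := Real.sqrt_pos.2 (by positivity)
  have hS2 : S ^ 2 = 3 * c₃ * n := Real.sq_sqrt (by positivity)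
  have e1 : -(c₄ * (-(3 * c₃ * n * η ^ 2)) ^ 2 / (9 * c₃ ^ 2 * n)) = -(c₄ * n * η ^ 4) := by
    field_simp; ring
  have e2 : (3 * c₃ * n * η ^ 2) ^ (3 / 2 : ℝ) = (S * η) ^ 3 := by
    have : 3 * c₃ * n * η ^ 2 = (S * η) ^ (2 : ℝ) := by
      rw [Real.rpow_two, mul_pow, hS2]
    rw [this, ← Real.rpow_mul (by positivity)]
    norm_num
  have e3 : 2 * (S * η) ^ 3 / (3 * S) = 2 * c₃ * n * η ^ 3 := by
    have : 2 * (S * η) ^ 3 / (3 * S) = 2 / 3 * S ^ 2 * η ^ 3 := by field_simp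
    rw [this, hS2]; ring
  have e4 : √(2 * (3 * c₃ * n * η ^ 2) / (3 * c₃ * n)) = √2 * η := by
    have : 2 * (3 * c₃ * n * η ^ 2) / (3 * c₃ * n) = 2 * η ^ 2 := by field_simp
    rw [this, Real.sqrt_mul (by norm_num), Real.sqrt_sq hη.le]
  have e5 : √(3 * c₃ * n * (3 * c₃ * n * η ^ 2)) = 3 * c₃ * n * η := by
    have : 3 * c₃ * n * (3 * c₃ * n * η ^ 2) = (3 * c₃ * n * η) ^ 2 := by ring
    rw [this, Real.sqrt_sq (by positivity)]
  rw [e1, e2, e3, e4, e5]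
  have h2 : √2 ≠ 0 := by positivity
  have e6 : √2 * ∫ t in (-η)..η, Real.exp (-(6 * (c₃ * n * η)) * t ^ 2)
      = ∫ u in (-(√2 * η))..(√2 * η), Real.exp (-(3 * c₃ * n * η * u ^ 2)) := by
    have h := intervalIntegral.smul_integral_comp_mul_left (a := -η) (b := η)
      (fun u => Real.exp (-(3 * c₃ * n * η * u ^ 2))) (√2)
    rw [mul_neg] at h
    rw [← h, smul_eq_mul]
    congr 2
    ext t
    congr 1
    rw [mul_pow, Real.sq_sqrt (by norm_num)]
    ring
  rw [e6]
  have hpi := Real.pi_ne_zero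
  field_simp

/-- Saddle point approximation of the Green's function on the oscillatory side, as long as the
saddle points stay close to the origin. -/
lemma exists_greenFn_sub_approxGreenFn_bound {a : ℤ → ℂ} {α c₃ c₄ : ℝ}
    (ha : DispersiveAssumption a α c₃ c₄) (hc₃ : 0 < c₃) :
    ∃ η₀ M : ℝ, 0 < η₀ ∧ 0 < M ∧ ∀ (n : ℕ) (j : ℤ) (η : ℝ), 1 ≤ n → 0 < η → η ≤ η₀ →
      (j : ℝ) - α * n = -(3 * c₃ * n * η ^ 2) →
      2 * Real.pi * ‖greenFn a n j - (approxGreenFn α c₃ c₄ n j : ℂ)‖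
        ≤ 3 * ((60 * c₄ * n * η ^ 3 / √(c₃ * n * η) * Real.exp (-(c₄ / 2 * (n * η ^ 4)))
          + 54 * (c₃ * n) ^ 2 / (c₃ * n * η) ^ 3) * √(Real.pi / (c₃ * n * η))
        + (η - -η) * (243 * M * n * η ^ 5 * Real.exp (-(c₄ / 2 * (n * η ^ 4)))))
        + 2 * (Real.exp (-(2 * (c₃ * n * η ^ 3))) * √(Real.pi / (c₃ * n * η / 2))) := by
  obtain ⟨r, M, hr, hM, hloc⟩ := exists_local_expansion ha
  obtain ⟨ε, D', hε, -, hhor⟩ := exists_norm_greenIntegrand_le ha hc₃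
  have hc₄ := ha.c₄_pos
  have hpi := Real.pi_pos
  set D := 900 * c₄ ^ 2 / c₃ + 243 * M
  have hD : 0 < D := by positivity
  refine ⟨min (min ε (r / 3)) (min 1 (c₄ / 2 / D)), M, by positivity, hM,
    fun n j η hn hη hη₀ hx => ?_⟩
  have hηε : η ≤ ε := hη₀.trans ((min_le_left _ _).trans (min_le_left _ _))
  have hηr : η ≤ r / 3 := hη₀.trans ((min_le_left _ _).trans (min_le_right _ _))
  have hη1 : η ≤ 1 := hη₀.trans ((min_le_right _ _).trans (min_le_left _ _))
  have hηD : D * η ≤ c₄ / 2 := by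
    rw [← le_div_iff₀' hD]
    exact hη₀.trans ((min_le_right _ _).trans (min_le_right _ _))
  have hn0 : (0 : ℝ) < n := by exact_mod_cast hn
  have hy : (-(j - α * n) : ℝ) = 3 * c₃ * n * η ^ 2 := by rw [hx]; ring
  set f := greenIntegrand a n j
  have hfc : Continuous f := continuous_greenIntegrand ha.finite_support n j
  set J := ∫ t in (-η)..η, Real.exp (-(6 * (c₃ * n * η)) * t ^ 2)
  set A := Complex.exp (saddleValue c₃ c₄ n η)
  set E := (60 * c₄ * n * η ^ 3 / √(c₃ * n * η) * Real.exp (-(c₄ / 2 * (n * η ^ 4)))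
          + 54 * (c₃ * n) ^ 2 / (c₃ * n * η) ^ 3) * √(Real.pi / (c₃ * n * η))
        + (η - -η) * (243 * M * n * η ^ 5 * Real.exp (-(c₄ / 2 * (n * η ^ 4))))
  set H := Real.exp (-(2 * (c₃ * n * η ^ 3))) * √(Real.pi / (c₃ * n * η / 2))
  have hnorm : ∀ t : ℝ, |t| ≤ η → ‖(η + t * (1 - Complex.I) : ℂ)‖ ≤ r := by
    intro t ht
    calc _ ≤ ‖(η : ℂ)‖ + ‖(t * (1 - Complex.I) : ℂ)‖ := norm_add_le _ _
      _ ≤ η + η * (3 / 2) := by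
        rw [norm_mul, Complex.norm_real, Complex.norm_real, Real.norm_of_nonneg hη.le,
          Real.norm_eq_abs]
        gcongr
        exact norm_one_sub_I_le
      _ ≤ r := by linarith
  have hrefl : ∀ t : ℝ, (-(η + t * (1 + Complex.I)) : ℂ) = -conj (η + t * (1 - Complex.I) : ℂ) := by
    intro t
    simp
  have hright := norm_integral_saddle_sub_le (f := fun t => f (η + t * (1 - Complex.I))) hc₃ hc₄ hM
    hn0 hη hηD (by fun_prop) (fun t ht => by
      obtain ⟨p, hp, h⟩ := hloc _ (hnorm t ht)
      refine ⟨p, hp, ?_⟩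
      rw [← hy]
      exact greenIntegrand_eq_exp n j h)
  have hleft := norm_integral_saddle_sub_le (f := fun t => conj (f (-(η + t * (1 + Complex.I))))) hc₃
    hc₄ hM hn0 hη hηD (by fun_prop) (fun t ht => by
      obtain ⟨p, hp, h⟩ := hloc (-(η + t * (1 + Complex.I))) (by
        rw [hrefl, norm_neg, Complex.norm_conj]; exact hnorm t ht)
      refine ⟨-conj p, by rwa [norm_neg, Complex.norm_conj], ?_⟩
      rw [← hy, ← conj_exp_reflect, ← hrefl]
      exact congrArg conj (greenIntegrand_eq_exp n j h))
  have hconj : ∫ t in (-η)..η, conj (f (-(η + t * (1 + Complex.I))))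
      = conj (∫ t in (-η)..η, f (-(η + t * (1 + Complex.I)))) := by
    simp only [intervalIntegral, integral_conj, map_sub]
  rw [hconj] at hleft
  set I₁ := ∫ t in (-η)..η, f (η + t * (1 - Complex.I))
  set I₂ := ∫ t in (-η)..η, f (-(η + t * (1 + Complex.I)))
  have hhoriz : ∀ u : ℝ, |u| ≤ Real.pi → 2 * η ≤ |u| → ‖f (u + (-η : ℝ) * Complex.I)‖
      ≤ Real.exp (-(2 * (c₃ * n * η ^ 3))) * Real.exp (-(c₃ * n * η / 2) * u ^ 2) := by
    intro u hu1 hu2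
    refine (hhor n j u η hu1 hη hηε).1.trans ?_
    rw [← Real.exp_add, hx]
    apply Real.exp_le_exp.2
    have h1 : (2 * η) ^ 2 ≤ u ^ 2 := by rw [← sq_abs u]; gcongr
    have h2 : c₃ * n * η * (2 * η) ^ 2 ≤ c₃ * n * η * u ^ 2 := by gcongr
    nlinarith
  have h2π : 2 * η ≤ Real.pi := by linarith [Real.pi_gt_three]
  have hH1 : ‖∫ u in (-Real.pi)..(-(2 * η)), f (u + (-η : ℝ) * Complex.I)‖ ≤ H :=
    norm_integral_le_of_le_gaussian (by positivity) (by linarith) (Real.exp_pos _).le fun u hu =>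
      hhoriz u (abs_le.2 ⟨hu.1, by linarith [hu.2]⟩) (by linarith [neg_le_abs u, hu.2])
  have hH2 : ‖∫ u in (2 * η)..Real.pi, f (u + (-η : ℝ) * Complex.I)‖ ≤ H :=
    norm_integral_le_of_le_gaussian (by positivity) (by linarith) (Real.exp_pos _).le fun u hu =>
      hhoriz u (abs_le.2 ⟨by linarith [hu.1], hu.2⟩) (by linarith [le_abs_self u, hu.1])
  have hi : ∀ s t : ℝ, IntervalIntegrable (fun u : ℝ => f (u + (-η : ℝ) * Complex.I))
      MeasureTheory.volume s t := fun s t => Continuous.intervalIntegrable (by fun_prop) _ _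
  have hG : (2 * Real.pi * greenFn a n j : ℂ)
      = (∫ u in (-Real.pi)..(-(2 * η)), f (u + (-η : ℝ) * Complex.I))
        + (I₁ * (1 - Complex.I) + I₂ * (1 + Complex.I))
        + ∫ u in (2 * η)..Real.pi, f (u + (-η : ℝ) * Complex.I) := by
    have hob := integral_eq_integral_oblique
      (differentiable_greenIntegrand ha.finite_support n j) η
    rw [intervalIntegral.integral_mul_const, intervalIntegral.integral_mul_const] at hob
    rw [two_pi_mul_greenFn ha.finite_support (-η), ← hob,
      intervalIntegral.integral_add_adjacent_intervals (hi _ _) (hi _ _),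
      intervalIntegral.integral_add_adjacent_intervals (hi _ _) (hi _ _)]
  have happ : (2 * Real.pi * approxGreenFn α c₃ c₄ n j : ℂ)
      = A * J * (1 - Complex.I) + conj (A * J) * (1 + Complex.I) := by
    have h := saddleValue_main_add_conj c₃ c₄ n η J
    rw [← two_pi_mul_approxGreenFn hc₃ hn hη hx] at h
    push_cast at h
    rw [← h, map_mul (starRingEnd ℂ) (_ * _) (1 - Complex.I)]
    simp [A]
  have hω : ‖(1 + Complex.I : ℂ)‖ ≤ 3 / 2 := by
    have : (1 + Complex.I : ℂ) = conj (1 - Complex.I) := by simp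
    rw [this, Complex.norm_conj]
    exact norm_one_sub_I_le
  have hleft' : ‖I₂ - conj (A * J)‖ ≤ E := by
    rw [← Complex.norm_conj, map_sub, Complex.conj_conj]
    exact hleft
  have hE : 0 ≤ E := (norm_nonneg _).trans hright
  have hnormeq : 2 * Real.pi * ‖greenFn a n j - (approxGreenFn α c₃ c₄ n j : ℂ)‖
      = ‖(2 * Real.pi * greenFn a n j - 2 * Real.pi * approxGreenFn α c₃ c₄ n j : ℂ)‖ := by
    rw [← mul_sub, norm_mul, norm_mul, Complex.norm_ofNat, Complex.norm_real,
      Real.norm_of_nonneg hpi.le]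
  rw [hnormeq, hG, happ]
  set H₁ := ∫ u in (-Real.pi)..(-(2 * η)), f (u + (-η : ℝ) * Complex.I)
  set H₂ := ∫ u in (2 * η)..Real.pi, f (u + (-η : ℝ) * Complex.I)
  have e : H₁ + (I₁ * (1 - Complex.I) + I₂ * (1 + Complex.I)) + H₂
      - (A * J * (1 - Complex.I) + conj (A * J) * (1 + Complex.I))
      = H₁ + (I₁ - A * J) * (1 - Complex.I) + (I₂ - conj (A * J)) * (1 + Complex.I) + H₂ := by
    ring
  rw [e]
  calc _ ≤ ‖H₁‖ + ‖(I₁ - A * J) * (1 - Complex.I)‖ + ‖(I₂ - conj (A * J)) * (1 + Complex.I)‖ + ‖H₂‖ :=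
        (norm_add_le _ _).trans (add_le_add_left ((norm_add_le _ _).trans
          (add_le_add_left (norm_add_le _ _) _)) _)
    _ ≤ H + E * (3 / 2) + E * (3 / 2) + H := by
        rw [norm_mul, norm_mul]
        gcongr
        exact norm_one_sub_I_le
    _ = _ := by ring

/-! ### Comparison of the errors with the profile -/

lemma inv_cube_le_decayProfile {c₃ N q : ℝ} (hc₃ : 0 < c₃) (hN : 0 < N) (hq : 0 < q)
    (hs : 1 ≤ 3 * c₃ * q ^ 2) :
    1 / (N * q ^ 3) ≤ √(6 * c₃) ^ 3 * decayProfile N (3 * c₃ * N * q ^ 2) := by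
  have h1 : √(1 + 3 * c₃ * N * q ^ 2 / N) ≤ √(6 * c₃) * q := by
    rw [← Real.sqrt_sq hq.le, ← Real.sqrt_mul (by positivity), Real.sqrt_sq hq.le]
    apply Real.sqrt_le_sqrt
    have : 3 * c₃ * N * q ^ 2 / N = 3 * c₃ * q ^ 2 := by field_simp
    linarith
  have h2 : 0 < √(1 + 3 * c₃ * N * q ^ 2 / N) := Real.sqrt_pos.2 (by positivity)
  have h3 : √(1 + 3 * c₃ * N * q ^ 2 / N) ^ 3 ≤ (√(6 * c₃) * q) ^ 3 := by gcongr
  unfold decayProfile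
  rw [mul_one_div, div_le_div_iff₀ (by positivity) (by positivity)]
  calc 1 * (N * √(1 + 3 * c₃ * N * q ^ 2 / N) ^ 3) ≤ 1 * (N * (√(6 * c₃) * q) ^ 3) := by gcongr
    _ = _ := by ring

/-- The error terms governed by the cubic dispersion decay at scale `N = n ^ (1/3)`. -/
lemma exists_cubic_error_le {c₃ : ℝ} (hc₃ : 0 < c₃) :
    ∃ C : ℝ, 0 < C ∧ ∀ N η : ℝ, 0 < N → 0 < η → N ≤ 3 * c₃ * N ^ 3 * η ^ 2 →
      54 * (c₃ * N ^ 3) ^ 2 / (c₃ * N ^ 3 * η) ^ 3 * √(Real.pi / (c₃ * N ^ 3 * η))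
          ≤ C * decayProfile N (3 * c₃ * N ^ 3 * η ^ 2) ∧
      Real.exp (-(2 * (c₃ * N ^ 3 * η ^ 3))) * √(Real.pi / (c₃ * N ^ 3 * η / 2))
          ≤ C * decayProfile N (3 * c₃ * N ^ 3 * η ^ 2) := by
  have hpi := Real.pi_pos
  set q₀ := √(1 / (3 * c₃))
  have hq₀ : 0 < q₀ := Real.sqrt_pos.2 (by positivity)
  set S := √(Real.pi / (c₃ * q₀ / 2))
  have hS : 0 < S := Real.sqrt_pos.2 (by positivity)
  refine ⟨(54 / c₃ + 1 / (2 * c₃)) * S * √(6 * c₃) ^ 3, by positivity, fun N η hN hη hs => ?_⟩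
  obtain ⟨q, hq, rfl⟩ : ∃ q : ℝ, 0 < q ∧ η = q / N := ⟨N * η, by positivity, by field_simp⟩
  have hs1 : 1 ≤ 3 * c₃ * q ^ 2 := by
    have : 3 * c₃ * N ^ 3 * (q / N) ^ 2 = N * (3 * c₃ * q ^ 2) := by field_simp
    rw [this] at hs
    exact le_of_mul_le_mul_left (by linarith) hN
  have hqq : q₀ ≤ q := by
    rw [← Real.sqrt_sq hq.le]
    apply Real.sqrt_le_sqrt
    rw [div_le_iff₀ (by positivity)]
    linarith
  have hy : 3 * c₃ * N ^ 3 * (q / N) ^ 2 = 3 * c₃ * N * q ^ 2 := by field_simp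
  have hK : c₃ * N ^ 3 * (q / N) = c₃ * q * N ^ 2 := by field_simp
  have hz : 2 * (c₃ * N ^ 3 * (q / N) ^ 3) = 2 * (c₃ * q ^ 3) := by field_simp
  have hp := inv_cube_le_decayProfile hc₃ hN hq hs1
  have hS1 : √(Real.pi / (c₃ * q * N ^ 2 / 2)) ≤ S / N := by
    have : Real.pi / (c₃ * q * N ^ 2 / 2) = Real.pi / (c₃ * q / 2) / N ^ 2 := by
      field_simp
    rw [this, Real.sqrt_div (by positivity), Real.sqrt_sq hN.le]
    gcongr
    apply Real.sqrt_le_sqrt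
    gcongr
  have hS2 : √(Real.pi / (c₃ * q * N ^ 2)) ≤ S / N := by
    refine le_trans (Real.sqrt_le_sqrt ?_) hS1
    apply div_le_div_of_nonneg_left hpi.le (by positivity)
    have : 0 < c₃ * q * N ^ 2 := by positivity
    linarith
  have hexp : Real.exp (-(2 * (c₃ * q ^ 3))) ≤ 1 / (2 * (c₃ * q ^ 3)) := by
    rw [Real.exp_neg, ← one_div]
    apply one_div_le_one_div_of_le (by positivity)
    linarith [Real.add_one_le_exp (2 * (c₃ * q ^ 3))]
  rw [hy, hK, hz]
  set P := √(6 * c₃) ^ 3 * decayProfile N (3 * c₃ * N * q ^ 2)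
  have hP : 0 ≤ P := le_trans (by positivity) hp
  constructor
  · calc _ ≤ 54 * (c₃ * N ^ 3) ^ 2 / (c₃ * q * N ^ 2) ^ 3 * (S / N) := by gcongr
      _ = 54 / c₃ * S * (1 / (N * q ^ 3)) := by field_simp
      _ ≤ (54 / c₃ + 1 / (2 * c₃)) * S * P := by
          gcongr
          have : 0 < 1 / (2 * c₃) := by positivity
          linarith
      _ = _ := by ring
  · calc _ ≤ 1 / (2 * (c₃ * q ^ 3)) * (S / N) := by gcongr
      _ = 1 / (2 * c₃) * S * (1 / (N * q ^ 3)) := by field_simp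
      _ ≤ (54 / c₃ + 1 / (2 * c₃)) * S * P := by
          gcongr
          have : 0 < 54 / c₃ := by positivity
          linarith
      _ = _ := by ring

/-- The error terms governed by the quartic dissipation decay at scale `m = n ^ (1/2)`. -/
lemma exists_quartic_error_le {c₃ c₄ : ℝ} (hc₃ : 0 < c₃) (hc₄ : 0 < c₄) :
    ∃ C : ℝ, 0 < C ∧ ∀ m η : ℝ, 0 < m → 0 < η →
      η ^ 2 * (1 + m ^ 2 * η ^ 4) * Real.exp (-(c₄ / 2 * (m ^ 2 * η ^ 4)))
        ≤ C * decayProfile m (3 * c₃ * m ^ 2 * η ^ 2) := by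
  obtain ⟨C, hC, h⟩ := exists_exp_le_decayProfile (c := c₄ / (3 * c₃)) (by positivity) 3
  set b := 1 / (3 * c₃)
  have hb : 0 < b := by positivity
  refine ⟨b * (1 + b ^ 2) * Real.exp (c₄ / 2) * C, by positivity, fun m η hm hη => ?_⟩
  set s := 3 * c₃ * m ^ 2 * η ^ 2 / m with hs
  have hs0 : 0 ≤ s := by positivity
  have hw : m * η ^ 2 = b * s := by rw [hs]; simp only [b]; field_simp
  have hη2 : η ^ 2 = b * s / m := by rw [← hw]; field_simp
  have hη4 : m ^ 2 * η ^ 4 = (b * s) ^ 2 := by rw [← hw]; ring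
  have hexp : Real.exp (-(c₄ / 2 * (b * s) ^ 2))
      ≤ Real.exp (c₄ / 2) * Real.exp (-(c₄ / (3 * c₃) * s)) := by
    rw [← Real.exp_add]
    apply Real.exp_le_exp.2
    have : c₄ / (3 * c₃) * s = c₄ * (b * s) := by simp only [b]; ring
    rw [this]
    nlinarith [mul_nonneg hc₄.le (sq_nonneg (b * s - 1))]
  have h1 := h m (3 * c₃ * m ^ 2 * η ^ 2) hm (by positivity)
  rw [← hs] at h1
  generalize decayProfile m (3 * c₃ * m ^ 2 * η ^ 2) = P at h1 ⊢
  rw [hη4, hη2]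
  calc b * s / m * (1 + (b * s) ^ 2) * Real.exp (-(c₄ / 2 * (b * s) ^ 2))
      ≤ b * (1 + s) / m * ((1 + b ^ 2) * (1 + s) ^ 2)
          * (Real.exp (c₄ / 2) * Real.exp (-(c₄ / (3 * c₃) * s))) := by
        gcongr
        · linarith
        · have : 0 ≤ b ^ 2 * s := by positivity
          nlinarith [sq_nonneg b, sq_nonneg s]
    _ = b * (1 + b ^ 2) * Real.exp (c₄ / 2)
          * ((1 + s) ^ 3 * Real.exp (-(c₄ / (3 * c₃) * s)) / m) := by ring
    _ ≤ b * (1 + b ^ 2) * Real.exp (c₄ / 2) * (C * P) := by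
        gcongr
    _ = _ := by ring

lemma abs_approxGreenFn_le {α c₃ c₄ : ℝ} (hc₃ : 0 < c₃) {n : ℕ} (hn : 1 ≤ n) {j : ℤ} {η : ℝ}
    (hη : 0 < η) (hx : (j : ℝ) - α * n = -(3 * c₃ * n * η ^ 2)) :
    |approxGreenFn α c₃ c₄ n j| ≤ η * Real.exp (-(c₄ * n * η ^ 4)) := by
  have h := two_pi_mul_approxGreenFn (c₄ := c₄) hc₃ hn hη hx
  have hpi := Real.pi_gt_three
  have hJ : |∫ t in (-η)..η, Real.exp (-(6 * (c₃ * n * η)) * t ^ 2)| ≤ 1 * |η - -η| := by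
    rw [← Real.norm_eq_abs]
    refine intervalIntegral.norm_integral_le_of_norm_le_const fun t _ => ?_
    rw [Real.norm_of_nonneg (Real.exp_pos _).le, Real.exp_le_one_iff]
    have : 0 ≤ 6 * (c₃ * n * η) * t ^ 2 := by positivity
    linarith
  rw [one_mul, sub_neg_eq_add, ← two_mul, abs_of_pos (by positivity : 0 < 2 * η)] at hJ
  have h2 : √2 ≤ 3 / 2 := by
    rw [Real.sqrt_le_left (by norm_num)]; norm_num
  have h' := congrArg abs h
  simp only [abs_mul, Real.abs_exp, abs_of_nonneg (Real.sqrt_nonneg 2),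
    abs_of_pos Real.pi_pos, abs_two] at h'
  have hle : 2 * Real.pi * |approxGreenFn α c₃ c₄ n j|
      ≤ 2 * Real.exp (-(c₄ * n * η ^ 4)) * 1 * (3 / 2 * (2 * η)) := by
    rw [h']
    gcongr
    exact Real.abs_cos_le_one _
  have h3 : 2 * 3 * |approxGreenFn α c₃ c₄ n j| ≤ 2 * Real.pi * |approxGreenFn α c₃ c₄ n j| := by
    gcongr
  linarith

/-- In the Airy layer the approximate Green's function has the size `n ^ (-1/3)`. -/
lemma exists_approxGreenFn_bound_layer (α c₄ : ℝ) {c₃ : ℝ} (hc₃ : 0 < c₃) (hc₄ : 0 < c₄) :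
    ∃ C : ℝ, 0 < C ∧ ∀ (n : ℕ) (j : ℤ) (N η : ℝ), 1 ≤ n → 0 < N → N ^ 3 = n → 0 < η →
      (j : ℝ) - α * n = -(3 * c₃ * n * η ^ 2) → |(j : ℝ) - α * n| ≤ N →
      |approxGreenFn α c₃ c₄ n j| ≤ C * decayProfile N |j - α * n| := by
  set q₀ := √(1 / (3 * c₃))
  have hq₀ : 0 < q₀ := Real.sqrt_pos.2 (by positivity)
  refine ⟨q₀ * √2 ^ 3, by positivity, fun n j N η hn hN hNn hη hx hle => ?_⟩
  refine (abs_approxGreenFn_le hc₃ hn hη hx).trans ?_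
  have hexp : Real.exp (-(c₄ * n * η ^ 4)) ≤ 1 := by
    rw [Real.exp_le_one_iff]
    have : 0 ≤ c₄ * n * η ^ 4 := by positivity
    linarith
  have hηN : η ≤ q₀ / N := by
    rw [le_div_iff₀ hN, ← Real.sqrt_sq (by positivity : 0 ≤ η * N)]
    apply Real.sqrt_le_sqrt
    rw [le_div_iff₀ (by positivity)]
    rw [hx, abs_neg, abs_of_pos (by positivity), ← hNn] at hle
    refine le_of_mul_le_mul_left ?_ hN
    linarith
  have hp : 1 / (N * √2 ^ 3) ≤ decayProfile N |(j : ℝ) - α * n| := by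
    unfold decayProfile
    have h1 : |(j : ℝ) - α * n| / N ≤ 1 := by rwa [div_le_one hN]
    have h0 : 0 ≤ |(j : ℝ) - α * n| / N := by positivity
    have h2 : 0 < √(1 + |(j : ℝ) - α * n| / N) := Real.sqrt_pos.2 (by linarith)
    gcongr
    linarith
  calc η * Real.exp (-(c₄ * n * η ^ 4)) ≤ q₀ / N * 1 := by gcongr
    _ = q₀ * √2 ^ 3 * (1 / (N * √2 ^ 3)) := by field_simp
    _ ≤ _ := by gcongr

lemma exists_approxGreenFn_bound_far (α : ℝ) {c₃ c₄ ρ : ℝ} (hc₃ : 0 < c₃) (hc₄ : 0 < c₄)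
    (hρ : 0 < ρ) :
    ∃ C : ℝ, 0 < C ∧ ∀ (n : ℕ) (j : ℤ) (η : ℝ), 1 ≤ n → 0 < η →
      (j : ℝ) - α * n = -(3 * c₃ * n * η ^ 2) → (j : ℝ) - α * n ≤ -(ρ * n) →
      |approxGreenFn α c₃ c₄ n j| ≤ C * decayProfile 1 |j - α * n| := by
  set b := 1 / (3 * c₃) with hb_def
  have hb : 0 < b := by positivity
  obtain ⟨C, hC, h⟩ := exists_exp_le_decayProfile (c := c₄ * b * (b * ρ)) (by positivity) 1
  refine ⟨(1 + b) * C, by positivity, fun n j η hn hη hx hle => ?_⟩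
  have hn1 : (1 : ℝ) ≤ n := by exact_mod_cast hn
  refine (abs_approxGreenFn_le hc₃ hn hη hx).trans ?_
  have h1 := h 1 |j - α * n| one_pos (abs_nonneg _)
  set y := |(j : ℝ) - α * n| with hy
  have hyη : y = 3 * c₃ * n * η ^ 2 := by rw [hy, hx, abs_neg, abs_of_pos (by positivity)]
  have hby : b * y = n * η ^ 2 := by rw [hyη, hb_def]; field_simp
  have hρη : b * ρ ≤ η ^ 2 := by
    refine le_of_mul_le_mul_left ?_ (by linarith : (0 : ℝ) < n)
    rw [← hby]
    have : ρ * n ≤ y := by rw [hyη]; linarith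
    calc (n : ℝ) * (b * ρ) = b * (ρ * n) := by ring
      _ ≤ b * y := by gcongr
  have hη1 : η ≤ (1 + b) * (1 + y) := by
    have h2 : η ^ 2 ≤ b * y := by rw [hby]; nlinarith [sq_nonneg η]
    have : 0 ≤ y := abs_nonneg _
    nlinarith [sq_nonneg (η - 1), mul_nonneg hb.le this]
  have hexp : Real.exp (-(c₄ * n * η ^ 4)) ≤ Real.exp (-(c₄ * b * (b * ρ) * y)) := by
    apply Real.exp_le_exp.2
    have : c₄ * (b * y) * (b * ρ) ≤ c₄ * (b * y) * η ^ 2 := by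
      have : 0 ≤ y := abs_nonneg _
      gcongr
    rw [hby] at this
    have e : c₄ * b * (b * ρ) * y = c₄ * (n * η ^ 2) * (b * ρ) := by rw [← hby]; ring
    rw [e]
    linarith
  rw [div_one, div_one, pow_one] at h1
  calc _ ≤ (1 + b) * (1 + y) * Real.exp (-(c₄ * b * (b * ρ) * y)) := by gcongr
    _ = (1 + b) * ((1 + y) * Real.exp (-(c₄ * b * (b * ρ) * y))) := by ring
    _ ≤ (1 + b) * (C * decayProfile 1 y) := by gcongr
    _ = _ := by ring

/-- The sum of the profiles at the three scales `n ^ (1/3)`, `n ^ (1/2)` and `1` that occur in the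
error bounds. -/
noncomputable def errorProfile (n : ℕ) (y : ℝ) : ℝ :=
  decayProfile ((n : ℝ) ^ (1 / 3 : ℝ)) y + decayProfile √n y + decayProfile 1 y

/-- The error of the saddle point approximation between the Airy layer and distance `ρ n`. -/
lemma exists_error_bound_middle {a : ℤ → ℂ} {α c₃ c₄ : ℝ}
    (ha : DispersiveAssumption a α c₃ c₄) (hc₃ : 0 < c₃) :
    ∃ ρ C : ℝ, 0 < ρ ∧ 0 < C ∧ ∀ (n : ℕ) (j : ℤ) (N m η : ℝ), 1 ≤ n → 0 < N → N ^ 3 = n →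
      0 < m → m ^ 2 = n → 0 < η → (j : ℝ) - α * n = -(3 * c₃ * n * η ^ 2) →
      (j : ℝ) - α * n ≤ -N → -(ρ * n) ≤ (j : ℝ) - α * n →
      ‖greenFn a n j - (approxGreenFn α c₃ c₄ n j : ℂ)‖
        ≤ C * (decayProfile N |j - α * n| + decayProfile m |j - α * n|) := by
  obtain ⟨η₀, M, hη₀, hM, hmain⟩ := exists_greenFn_sub_approxGreenFn_bound ha hc₃
  have hc₄ := ha.c₄_pos
  obtain ⟨C₁, hC₁, hcub⟩ := exists_cubic_error_le hc₃
  obtain ⟨C₂, hC₂, hquart⟩ := exists_quartic_error_le hc₃ hc₄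
  have hpi := Real.pi_gt_three
  set B := 60 * c₄ * √Real.pi / c₃ + 486 * M
  have hB : 0 < B := by positivity
  refine ⟨3 * c₃ * η₀ ^ 2, 5 * C₁ + 3 * B * C₂, by positivity, by positivity,
    fun n j N m η hn hN hNn hm hmn hη hx hxN hxρ => ?_⟩
  have hn0 : (0 : ℝ) < n := by exact_mod_cast hn
  have hηη₀ : η ≤ η₀ := by
    rw [hx, neg_le_neg_iff] at hxρ
    have : 3 * c₃ * n * η ^ 2 ≤ 3 * c₃ * n * η₀ ^ 2 := by linarith
    have := le_of_mul_le_mul_left this (by positivity)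
    exact (sq_le_sq₀ hη.le hη₀.le).1 this
  have hy : |(j : ℝ) - α * n| = 3 * c₃ * n * η ^ 2 := by
    rw [hx, abs_neg, abs_of_pos (by positivity)]
  have h := hmain n j η hn hη hηη₀ hx
  obtain ⟨h1, h2⟩ := hcub N η hN hη (by rw [hNn]; linarith)
  have h3 := hquart m η hm hη
  rw [hNn] at h1 h2
  rw [hmn] at h3
  rw [hy]
  set P := decayProfile N (3 * c₃ * n * η ^ 2)
  set Q := decayProfile m (3 * c₃ * n * η ^ 2)
  set G := Real.exp (-(c₄ / 2 * (n * η ^ 4)))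
  have hG : 0 < G := Real.exp_pos _
  have hP : 0 ≤ P := decayProfile_nonneg hN.le
  have hQ : 0 ≤ Q := decayProfile_nonneg hm.le
  have hquad : 60 * c₄ * n * η ^ 3 / √(c₃ * n * η) * G * √(Real.pi / (c₃ * n * η))
      = 60 * c₄ * √Real.pi / c₃ * (η ^ 2 * G) := by
    have hK := Real.mul_self_sqrt (by positivity : 0 ≤ c₃ * n * η)
    rw [Real.sqrt_div Real.pi_pos.le]
    have : 60 * c₄ * n * η ^ 3 / √(c₃ * n * η) * G * (√Real.pi / √(c₃ * n * η))
        = 60 * c₄ * n * η ^ 3 * G * √Real.pi / (√(c₃ * n * η) * √(c₃ * n * η)) := by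
      field_simp
    rw [this, hK]
    field_simp
  have hsum : 60 * c₄ * √Real.pi / c₃ * (η ^ 2 * G) + (η - -η) * (243 * M * n * η ^ 5 * G)
      ≤ B * (C₂ * Q) := by
    calc _ = 60 * c₄ * √Real.pi / c₃ * (η ^ 2 * G) + 486 * M * (η ^ 2 * (n * η ^ 4) * G) := by ring
      _ ≤ 60 * c₄ * √Real.pi / c₃ * (η ^ 2 * (1 + n * η ^ 4) * G)
          + 486 * M * (η ^ 2 * (1 + n * η ^ 4) * G) := by
          gcongr
          · apply le_mul_of_one_le_right (by positivity)
            have : 0 ≤ n * η ^ 4 := by positivity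
            linarith
          · linarith
      _ = B * (η ^ 2 * (1 + n * η ^ 4) * G) := by ring
      _ ≤ _ := by gcongr
  have htot : 2 * Real.pi * ‖greenFn a n j - (approxGreenFn α c₃ c₄ n j : ℂ)‖
      ≤ 5 * (C₁ * P) + 3 * (B * (C₂ * Q)) := by
    refine h.trans ?_
    rw [add_mul, hquad]
    linarith
  have h4 : 1 * ‖greenFn a n j - (approxGreenFn α c₃ c₄ n j : ℂ)‖
      ≤ 2 * Real.pi * ‖greenFn a n j - (approxGreenFn α c₃ c₄ n j : ℂ)‖ := by
    gcongr; linarith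
  have h5 : 0 ≤ C₁ * Q := by positivity
  have h6 : 0 ≤ B * C₂ * P := by positivity
  nlinarith

/-- The three regimes, separated by `|x| = n ^ (1/3)` and `|x| = ρ n`, put together. -/
lemma exists_pointwise_bound {a : ℤ → ℂ} {α c₃ c₄ : ℝ}
    (ha : DispersiveAssumption a α c₃ c₄) (hc₃ : 0 < c₃) :
    ∃ C : ℝ, 0 < C ∧ ∀ (n : ℕ) (j : ℤ), 1 ≤ n →
      (0 ≤ (j : ℝ) - α * n → ‖greenFn a n j‖ ≤ C * errorProfile n |j - α * n|) ∧
      ((j : ℝ) - α * n < 0 → ‖greenFn a n j - (approxGreenFn α c₃ c₄ n j : ℂ)‖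
        ≤ C * errorProfile n |j - α * n|) := by
  have hc₄ := ha.c₄_pos
  obtain ⟨C₁, hC₁, hright⟩ := exists_greenFn_bound_right ha hc₃
  obtain ⟨C₂, hC₂, hlayer⟩ := exists_approxGreenFn_bound_layer α c₄ hc₃ hc₄
  obtain ⟨ρ, C₃, hρ, hC₃, hmid⟩ := exists_error_bound_middle ha hc₃
  obtain ⟨C₄, hC₄, hfar⟩ := exists_greenFn_bound_far_left ha hc₃ hρ
  obtain ⟨C₅, hC₅, hfar'⟩ := exists_approxGreenFn_bound_far α hc₃ hc₄ hρ
  refine ⟨C₁ + C₂ + C₃ + C₄ + C₅, by positivity, fun n j hn => ?_⟩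
  have hn1 : (1 : ℝ) ≤ n := by exact_mod_cast hn
  have hn0 : (0 : ℝ) < n := by linarith
  unfold errorProfile
  set N := (n : ℝ) ^ (1 / 3 : ℝ)
  have hN : 1 ≤ N := Real.one_le_rpow hn1 (by norm_num)
  have hN0 : 0 < N := by linarith
  have hN3 : N ^ 3 = n := by
    rw [← Real.rpow_natCast, ← Real.rpow_mul hn0.le]; norm_num
  set m := √(n : ℝ)
  have hm : 0 < m := Real.sqrt_pos.2 hn0
  have hm2 : m ^ 2 = n := Real.sq_sqrt hn0.le
  set x : ℝ := j - α * n with hxdef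
  have hP : 0 ≤ decayProfile N |x| := decayProfile_nonneg hN0.le
  have hQ : 0 ≤ decayProfile m |x| := decayProfile_nonneg hm.le
  have hR : 0 ≤ decayProfile 1 |x| := decayProfile_nonneg zero_le_one
  set P := decayProfile N |x|
  set Q := decayProfile m |x|
  set R := decayProfile 1 |x|
  have hmono : ∀ {A T : ℝ}, A ≤ C₁ + C₂ + C₃ + C₄ + C₅ → T ≤ P + Q + R → 0 ≤ T →
      A * T ≤ (C₁ + C₂ + C₃ + C₄ + C₅) * (P + Q + R) := fun h1 h2 h3 => by gcongr
  refine ⟨fun hx => (hright n j N hN hN3 (by linarith)).trans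
    (hmono (by linarith) (by linarith) hP), fun hx => ?_⟩
  obtain ⟨η, hη, hxη⟩ : ∃ η : ℝ, 0 < η ∧ x = -(3 * c₃ * n * η ^ 2) := by
    have h : 0 < -x / (3 * c₃ * n) := div_pos (by linarith) (by positivity)
    refine ⟨√(-x / (3 * c₃ * n)), Real.sqrt_pos.2 h, ?_⟩
    rw [Real.sq_sqrt h.le]
    field_simp
  have htri : ‖greenFn a n j - (approxGreenFn α c₃ c₄ n j : ℂ)‖
      ≤ ‖greenFn a n j‖ + |approxGreenFn α c₃ c₄ n j| := by
    refine (norm_sub_le _ _).trans ?_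
    rw [Complex.norm_real, Real.norm_eq_abs]
  by_cases h1 : -N ≤ x
  · have e1 := hright n j N hN hN3 h1
    have e2 := hlayer n j N η hn hN0 hN3 hη hxη (abs_le.2 ⟨h1, by linarith⟩)
    refine (htri.trans (add_le_add e1 e2)).trans ?_
    rw [← add_mul]
    exact hmono (by linarith) (by linarith) hP
  · push Not at h1
    by_cases h2 : x ≤ -(ρ * n)
    · have e1 := hfar n j h2
      have e2 := hfar' n j η hn hη hxη h2
      refine (htri.trans (add_le_add e1 e2)).trans ?_
      rw [← add_mul]
      exact hmono (by linarith) (by linarith) hR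
    · push Not at h2
      exact (hmid n j N m η hn hN0 hN3 hm hm2 hη hxη h1.le h2.le).trans
        (hmono (by linarith) (by linarith) (by linarith))

/-! ### Summation over the lattice -/

lemma summable_errorProfile {n : ℕ} (hn : 1 ≤ n) (β : ℝ) :
    Summable (fun j : ℤ => errorProfile n |(j : ℝ) - β|) ∧
      ∑' j : ℤ, errorProfile n |(j : ℝ) - β| ≤ 144 := by
  have hn1 : (1 : ℝ) ≤ n := by exact_mod_cast hn
  obtain ⟨s1, t1⟩ := summable_decayProfile_and_tsum_le
    (Real.one_le_rpow hn1 (by norm_num : (0 : ℝ) ≤ 1 / 3)) β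
  obtain ⟨s2, t2⟩ := summable_decayProfile_and_tsum_le (Real.one_le_sqrt.2 hn1) β
  obtain ⟨s3, t3⟩ := summable_decayProfile_and_tsum_le le_rfl β
  refine ⟨(s1.add s2).add s3, ?_⟩
  unfold errorProfile
  rw [(s1.add s2).tsum_add s3, s1.tsum_add s2]
  linarith

lemma summable_subtype_and_tsum_le {p : ℤ → Prop} {f g : ℤ → ℝ} {B : ℝ} (hf : ∀ j, 0 ≤ f j)
    (hfg : ∀ j, p j → f j ≤ g j) (hg0 : ∀ j, 0 ≤ g j) (hg : Summable g) (hB : ∑' j, g j ≤ B) :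
    Summable (fun j : {j : ℤ // p j} => f j) ∧ ∑' j : {j : ℤ // p j}, f j ≤ B := by
  have hg' : Summable fun j : {j : ℤ // p j} => g j := hg.comp_injective Subtype.val_injective
  have hs : Summable fun j : {j : ℤ // p j} => f j :=
    Summable.of_nonneg_of_le (fun _ => hf _) (fun j => hfg j j.2) hg'
  exact ⟨hs, (hs.tsum_le_tsum (fun j : {j : ℤ // p j} => hfg j j.2) hg').trans
    ((hg.tsum_subtype_le g {j | p j} hg0).trans hB)⟩

theorem corollary1 (a : ℤ → ℂ) (α c₃ c₄ : ℝ) (ha : DispersiveAssumption a α c₃ c₄) (hc₃ : 0 < c₃) :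
    ∃ C : ℝ, 0 < C ∧ ∀ n : ℕ, 1 ≤ n →
      (Summable (fun j : {j : ℤ // 0 ≤ (j : ℝ) - α * n} => ‖greenFn a n j‖) ∧
        ∑' j : {j : ℤ // 0 ≤ (j : ℝ) - α * n}, ‖greenFn a n j‖ ≤ C) ∧
      (Summable (fun j : {j : ℤ // (j : ℝ) - α * n < 0} =>
          ‖greenFn a n j - (approxGreenFn α c₃ c₄ n j : ℂ)‖) ∧
        ∑' j : {j : ℤ // (j : ℝ) - α * n < 0},
          ‖greenFn a n j - (approxGreenFn α c₃ c₄ n j : ℂ)‖ ≤ C) := by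
  obtain ⟨C, hC, h⟩ := exists_pointwise_bound ha hc₃
  refine ⟨C * 144, by positivity, fun n hn => ?_⟩
  obtain ⟨hs, ht⟩ := summable_errorProfile hn (α * n)
  have h0 : ∀ j : ℤ, 0 ≤ C * errorProfile n |(j : ℝ) - α * n| := fun j => by
    have := decayProfile_nonneg (N := (n : ℝ) ^ (1 / 3 : ℝ)) (y := |(j : ℝ) - α * n|) (by positivity)
    have := decayProfile_nonneg (N := √n) (y := |(j : ℝ) - α * n|) (by positivity)
    have := decayProfile_nonneg (N := 1) (y := |(j : ℝ) - α * n|) zero_le_one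
    unfold errorProfile
    positivity
  have ht' : ∑' j : ℤ, C * errorProfile n |(j : ℝ) - α * n| ≤ C * 144 := by
    rw [tsum_mul_left]; gcongr
  exact ⟨summable_subtype_and_tsum_le (f := fun j => ‖greenFn a n j‖) (fun _ => norm_nonneg _)
      (fun j hj => (h n j hn).1 hj) h0 (hs.mul_left C) ht',
    summable_subtype_and_tsum_le
      (f := fun j => ‖greenFn a n j - (approxGreenFn α c₃ c₄ n j : ℂ)‖) (fun _ => norm_nonneg _)
      (fun j hj => (h n j hn).2 hj) h0 (hs.mul_left C) ht'⟩
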